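/- Let $M$ be a smooth manifold with a hypercomplex structure, i.e. integrable complex structures $I,J,K$ with $IJ=-JI=K$, and let $g$ be a hyperhermitian metric on $M$, i.e. a Riemannian metric for which $I,J,K$ are orthogonal. For $L\in\{I,J,K\}$ let $\omega_L(X,Y)=g(LX,Y)$ be the fundamental form and let $d^c_L\omega_L$ be the imaginary part of $\partial_L\omega_L=\pi^{2,1}_L(d\omega_L)$, where $\pi^{2,1}_L$ is the projection onto forms of type $(2,1)$ with respect to $L$. The metric $g$ is called HKT if $d^c_I\omega_I=d^c_J\omega_J=d^c_K\omega_K$. Let $P_I$ be the bivector dual to $\omega_I$: $P_I(\alpha,\beta)=\beta(\omega_I^{-1}\alpha)$, where $\omega_I^{-1}:T^*M\to TM$ is the inverse of $X\mapsto\omega_I(X,\cdot)$. Let $Z=M\times S^2$ be the twistor space, with its tautological complex structure $\mathcal I_{(x,\mathbf a)}=(I_{\mathbf a},I_{S^2})$, where $S^2\subset\mathbb R^3$ is the unit sphere, $I_{\mathbf a}=aI+bJ+cK$ for $\mathbf a=(a,b,c)\in S^2$, and $I_{S^2}v=\mathbf a\times v$ for $v\in T_{\mathbf a}S^2=\mathbf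 a^{\perp}$. For $\mathbf a\in S^2$ let $s_{\mathbf a}:M\to Z$, $s_{\mathbf a}(x)=(x,\mathbf a)$, and let $\mathcal P$ be the complex bivector field on $Z$ given by $\mathcal P_{(x,\mathbf a)}=\big((s_{\mathbf a})_*P_I\big)^{(2,0)}$, the component of type $(2,0)$ with respect to $\mathcal I$. Then $g$ is HKT if and only if $\mathcal P$ is a complex Poisson structure on $(Z,\mathcal I)$, i.e. a smooth bivector field of type $(2,0)$ whose Schouten bracket satisfies $[\mathcal P,\mathcal P]=0$. -/

import Mathlib

open scoped Manifold ContDiff Bundle RealInnerProductSpace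
open Bundle

noncomputable section

/-! ### Linear algebra at a point

`V` is a real tangent space and `J : V → V` a complex structure on it.  A complex covector is a
real-linear map `V → ℂ`, that is, an element of `V* ⊗ ℂ`. -/

section PointwiseAlgebra

variable {V W : Type*} [AddCommGroup V] [Module ℝ V] [TopologicalSpace V]
  [AddCommGroup W] [Module ℝ W] [TopologicalSpace W]

/-- Real part of a complex covector. -/
def covectorRe (α : V →L[ℝ] ℂ) : V →L[ℝ] ℝ := Complex.reCLM ∘L α

/-- Imaginary part of a complex covector. -/
def covectorIm (α : V →L[ℝ] ℂ) : V →L[ℝ] ℝ := Complex.imCLM ∘L α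

variable [IsTopologicalAddGroup V] [ContinuousSMul ℝ V]
  [IsTopologicalAddGroup W] [ContinuousSMul ℝ W]

/-- Complex bivectors `Λ²(V ⊗ ℂ)` on a finite-dimensional `V`, viewed as alternating
complex-bilinear forms on the space of complex covectors. -/
abbrev Bivector (V : Type*) [AddCommGroup V] [Module ℝ V] [TopologicalSpace V]
    [IsTopologicalAddGroup V] [ContinuousSMul ℝ V] :=
  (V →L[ℝ] ℂ) [⋀^Fin 2]→ₗ[ℂ] ℂ

/-- The `(1,0)`-part `α ↦ (α - i α ∘ J) / 2` of a complex covector. -/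
def covector10 (J : V →L[ℝ] V) : (V →L[ℝ] ℂ) →ₗ[ℂ] (V →L[ℝ] ℂ) where
  toFun α := (1 / 2 : ℂ) • (α - Complex.I • (α ∘L J))
  map_add' α β := by
    ext v
    simp
    ring
  map_smul' c α := by
    ext v
    simp
    ring

/-- The `(2,0)`-component of a bivector: it agrees with `B` on pairs of `(1,0)`-covectors and
vanishes as soon as one of the two covectors is of type `(0,1)`. -/
def Bivector.component20 (J : V →L[ℝ] V) (B : Bivector V) : Bivector V :=
  AlternatingMap.compLinearMap B (covector10 J)

/-- Push-forward of a bivector by a linear map `A : V → W`: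
`(A_* B)(α, β) = B(α ∘ A, β ∘ A)`. -/
def Bivector.pushforward (A : V →L[ℝ] W) (B : Bivector V) : Bivector W :=
  AlternatingMap.compLinearMap B
    { toFun := fun α : W →L[ℝ] ℂ => α ∘L A
      map_add' := fun _ _ => rfl
      map_smul' := fun _ _ => rfl }

/-- The value `σ⁻¹(α)` for a form `σ` viewed as the map `X ↦ σ(X, ·)` from `V` to `V*`;
meaningful when `σ` is nondegenerate. -/
def formInv (σ : V →L[ℝ] V →L[ℝ] ℝ) : (V →L[ℝ] ℝ) →L[ℝ] V := ContinuousLinearMap.inverse σ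

set_option linter.unusedSectionVars false in
theorem apply_formInv_self (σ : V →L[ℝ] V →L[ℝ] ℝ) (hσ : ∀ v, σ v v = 0) (α : V →L[ℝ] ℝ) :
    α (formInv σ α) = 0 := by
  unfold formInv
  by_cases h : σ.IsInvertible
  · obtain ⟨e, rfl⟩ := h
    rw [ContinuousLinearMap.inverse_equiv]
    simpa using hσ (e.symm α)
  · rw [ContinuousLinearMap.inverse_of_not_isInvertible h]
    simp

/-- The bivector dual to an alternating form `σ`: the complex-bilinear extension of
`σ⁻¹(α, β) = β(σ⁻¹(α))`. -/
def dualBivector (σ : V →L[ℝ] V →L[ℝ] ℝ) (hσ : ∀ v, σ v v = 0) : Bivector V where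
  toFun α := α 1 (formInv σ (covectorRe (α 0))) + Complex.I * α 1 (formInv σ (covectorIm (α 0)))
  map_update_add' := by
    intro inst α i β γ
    obtain rfl := Subsingleton.elim inst (instDecidableEqFin 2)
    fin_cases i <;> simp [covectorRe, covectorIm, ContinuousLinearMap.comp_add] <;> ring
  map_update_smul' := by
    intro inst α i c β
    obtain rfl := Subsingleton.elim inst (instDecidableEqFin 2)
    fin_cases i
    · have hre : covectorRe (c • β) = c.re • covectorRe β - c.im • covectorIm β := by
        ext v
        simp [covectorRe, covectorIm]
      have him : covectorIm (c • β) = c.re • covectorIm β + c.im • covectorRe β := by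
        ext v
        simp [covectorRe, covectorIm]
      simp only [Fin.zero_eta, Function.update_self, ne_eq, one_ne_zero, not_false_eq_true,
        Function.update_of_ne, hre, him, map_sub, map_add, map_smul, smul_eq_mul,
        Complex.real_smul]
      conv_rhs => rw [← Complex.re_add_im c]
      linear_combination (-(c.im : ℂ) * (α 1) (formInv σ (covectorIm β))) * Complex.I_sq
    · simp
      ring
  map_eq_zero_of_eq' := by
    intro α i j h hij
    have h01 : α 0 = α 1 := by
      fin_cases i <;> fin_cases j <;> simp_all
    have key : ∀ v, α 1 v = (covectorRe (α 1) v : ℂ) + Complex.I * (covectorIm (α 1) v : ℂ) := by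
      intro v
      simp only [covectorRe, covectorIm, ContinuousLinearMap.comp_apply, Complex.reCLM_apply,
        Complex.imCLM_apply]
      rw [mul_comm]
      exact (Complex.re_add_im _).symm
    have hs := apply_formInv_self σ hσ (covectorRe (α 1) + covectorIm (α 1))
    have h1 := apply_formInv_self σ hσ (covectorRe (α 1))
    have h2 := apply_formInv_self σ hσ (covectorIm (α 1))
    simp only [map_add, _root_.add_apply, h1, h2, zero_add, add_zero] at hs
    rw [h01, key, key (formInv σ (covectorIm (α 1))), h1, h2]
    have hs' : ((covectorRe (α 1) (formInv σ (covectorIm (α 1))) : ℝ) : ℂ) +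
        (covectorIm (α 1) (formInv σ (covectorRe (α 1))) : ℝ) = 0 := by
      rw [← Complex.ofReal_add]
      norm_cast
      linarith
    push_cast
    linear_combination Complex.I * hs'

/-- The alternating form attached to a continuous bilinear map vanishing on the diagonal. -/
def twoForm (σ : V →L[ℝ] V →L[ℝ] ℝ) (hσ : ∀ v, σ v v = 0)
    (hc : Continuous fun p : V × V => σ p.1 p.2) : V [⋀^Fin 2]→L[ℝ] ℝ where
  toFun v := σ (v 0) (v 1)
  map_update_add' := by
    intro inst v i x y
    obtain rfl := Subsingleton.elim inst (instDecidableEqFin 2)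
    fin_cases i <;> simp
  map_update_smul' := by
    intro inst v i c x
    obtain rfl := Subsingleton.elim inst (instDecidableEqFin 2)
    fin_cases i <;> simp
  map_eq_zero_of_eq' := by
    intro v i j h hij
    have h01 : v 0 = v 1 := by
      fin_cases i <;> fin_cases j <;> simp_all
    change σ (v 0) (v 1) = 0
    rw [h01]
    exact hσ _
  cont := by
    have h := hc.comp (g := fun p : V × V => σ p.1 p.2) (f := fun v : Fin 2 → V => (v 0, v 1))
      ((continuous_apply 0).prodMk (continuous_apply 1))
    exact h

/-- The component `π_{p, k-p} η` of type `(p, k-p)` of a complex-valued `k`-form, as a function of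
`k` vectors.  It is the sum, over the sets `S` of `p` slots, of the complex-multilinear extension of
`η` evaluated on the `(1,0)`-parts `(v - i J v) / 2` in the slots of `S` and the `(0,1)`-parts
`(v + i J v) / 2` in the other slots; here `T` is the set of slots in which the term `∓ i J v / 2`
is selected when this product is expanded. -/
def typeComponent {k : ℕ} (J : V →L[ℝ] V) (p : ℕ) (η : V [⋀^Fin k]→L[ℝ] ℂ) (v : Fin k → V) : ℂ :=
  ∑ S ∈ Finset.powersetCard p (Finset.univ : Finset (Fin k)), ∑ T : Finset (Fin k),
    (1 / 2 : ℂ) ^ k * (∏ i ∈ T, if i ∈ S then -Complex.I else Complex.I) *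
      η (fun i => if i ∈ T then J (v i) else v i)

end PointwiseAlgebra

/-! ### Exterior derivative of a form on a manifold -/

section ExteriorDerivative

variable {E : Type*} [NormedAddCommGroup E] [NormedSpace ℝ E]
  {M : Type*} [TopologicalSpace M] [ChartedSpace E M]
  {F : Type*} [NormedAddCommGroup F] [NormedSpace ℝ F]

/-- The expression of a differential form in the preferred chart at `x`
(its pull-back by the inverse of the chart). -/
def formInChart {k : ℕ} (σ : (x : M) → TangentSpace 𝓘(ℝ, E) x [⋀^Fin k]→L[ℝ] F) (x : M) (y : E) :
    E [⋀^Fin k]→L[ℝ] F :=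
  (σ ((extChartAt 𝓘(ℝ, E) x).symm y)).compContinuousLinearMap
    (mfderiv 𝓘(ℝ, E) 𝓘(ℝ, E) (extChartAt 𝓘(ℝ, E) x).symm y)

/-- The exterior derivative of a differential form, computed in the preferred chart. -/
def manifoldExtDeriv {k : ℕ} (σ : (x : M) → TangentSpace 𝓘(ℝ, E) x [⋀^Fin k]→L[ℝ] F) (x : M) :
    TangentSpace 𝓘(ℝ, E) x [⋀^Fin (k + 1)]→L[ℝ] F :=
  (extDeriv (formInChart σ x) (extChartAt 𝓘(ℝ, E) x x)).compContinuousLinearMap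
    (mvfderiv 𝓘(ℝ, E) (extChartAt 𝓘(ℝ, E) x) x)

/-- For a form `σ` of type `(p, q)`, the form `∂σ = π_{p+1, q} (dσ)`, as a function of vectors. -/
def delOperator (J : (x : M) → TangentSpace 𝓘(ℝ, E) x →L[ℝ] TangentSpace 𝓘(ℝ, E) x) (p q : ℕ)
    (σ : (x : M) → TangentSpace 𝓘(ℝ, E) x [⋀^Fin (p + q)]→L[ℝ] ℂ) (x : M)
    (v : Fin (p + q + 1) → TangentSpace 𝓘(ℝ, E) x) : ℂ :=
  typeComponent (J x) (p + 1) (manifoldExtDeriv σ x) v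

/-- For a real form `σ` of type `(p, q)`, the imaginary part `d^c σ` of `∂σ`. -/
def dcOperator (J : (x : M) → TangentSpace 𝓘(ℝ, E) x →L[ℝ] TangentSpace 𝓘(ℝ, E) x) (p q : ℕ)
    (σ : (x : M) → TangentSpace 𝓘(ℝ, E) x [⋀^Fin (p + q)]→L[ℝ] ℝ) (x : M)
    (v : Fin (p + q + 1) → TangentSpace 𝓘(ℝ, E) x) : ℝ :=
  (delOperator J p q (fun y => Complex.ofRealCLM.compContinuousAlternatingMap (σ y)) x v).im

end ExteriorDerivative

/-! ### Bivector fields, the Schouten bracket and complex Poisson structures -/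

section Poisson

variable {E H : Type*} [NormedAddCommGroup E] [NormedSpace ℝ E] [TopologicalSpace H]
  (I : ModelWithCorners ℝ E H) {N : Type*} [TopologicalSpace N] [ChartedSpace H N]

/-- The complex covector field `d(ℓ ∘ φ)`, where `φ` is the preferred chart at `z` and
`ℓ : E → ℂ` is real-linear: a covector field with constant coefficients in that chart. -/
def coordCovector (z : N) (l : E →L[ℝ] ℂ) (w : N) : TangentSpace I w →L[ℝ] ℂ :=
  l ∘L mvfderiv I (extChartAt I z) w

/-- The coefficient function `B(d(ℓ ∘ φ), d(m ∘ φ))` of a bivector field in the preferred chart `φ`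
at `z`. -/
def bivectorCoeff (B : (w : N) → Bivector (TangentSpace I w)) (z : N) (l m : E →L[ℝ] ℂ)
    (w : N) : ℂ :=
  B w ![coordCovector I z l w, coordCovector I z m w]

/-- A bivector field is smooth if its coefficients in the charts are smooth. -/
def SmoothBivector (B : (w : N) → Bivector (TangentSpace I w)) : Prop :=
  ∀ (z : N) (l m : E →L[ℝ] ℂ),
    ContMDiffOn I 𝓘(ℝ, ℂ) ∞ (bivectorCoeff I B z l m) (chartAt H z).source

/-- One half of a cyclic summand of the Schouten bracket: `A(dℓ, d(B(dm, dn)))`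
for linear coordinate functions `ℓ, m, n` at `z`. -/
def schoutenTerm (A B : (w : N) → Bivector (TangentSpace I w)) (z : N) (l m n : E →L[ℝ] ℂ) : ℂ :=
  A z ![coordCovector I z l z, mvfderiv I (bivectorCoeff I B z m n) z]

/-- The Schouten bracket `[A, B]` of two bivector fields at `z`, evaluated on three covectors:
`[A, B]^{lmn} = ∑_{cyclic} (A^{lh} ∂_h B^{mn} + B^{lh} ∂_h A^{mn})` in the coordinates at `z`. -/
def schoutenBracket (A B : (w : N) → Bivector (TangentSpace I w)) (z : N)
    (l m n : E →L[ℝ] ℂ) : ℂ :=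
  (schoutenTerm I A B z l m n + schoutenTerm I B A z l m n) +
  (schoutenTerm I A B z m n l + schoutenTerm I B A z m n l) +
  (schoutenTerm I A B z n l m + schoutenTerm I B A z n l m)

/-- A complex Poisson structure for an almost complex structure `J`: a smooth bivector field `P` of
type `(2,0)` with `[P, P] = 0`. -/
structure IsComplexPoisson (J : (z : N) → TangentSpace I z →L[ℝ] TangentSpace I z)
    (P : (z : N) → Bivector (TangentSpace I z)) : Prop where
  smooth : SmoothBivector I P
  type20 : ∀ z, (P z).component20 (J z) = P z
  bracket : ∀ (z : N) (l m n : E →L[ℝ] ℂ), schoutenBracket I P P z l m n = 0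

end Poisson

/-! ### Hypercomplex and HKT structures -/

section Hypercomplex

variable (E : Type*) [NormedAddCommGroup E] [NormedSpace ℝ E]
  (M : Type*) [TopologicalSpace M] [ChartedSpace E M] [IsManifold 𝓘(ℝ, E) ∞ M]

/-- A complex structure: a smooth field of endomorphisms of the tangent bundle with square `-1` and
vanishing Nijenhuis tensor. -/
structure ComplexStructure where
  toFun (x : M) : TangentSpace 𝓘(ℝ, E) x →L[ℝ] TangentSpace 𝓘(ℝ, E) x
  smooth : ContMDiff 𝓘(ℝ, E) (𝓘(ℝ, E).prod 𝓘(ℝ, E →L[ℝ] E)) ∞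
    (fun x => TotalSpace.mk' (E →L[ℝ] E)
      (E := fun x : M => TangentSpace 𝓘(ℝ, E) x →L[ℝ] TangentSpace 𝓘(ℝ, E) x) x (toFun x))
  sq (x : M) (v : TangentSpace 𝓘(ℝ, E) x) : toFun x (toFun x v) = -v
  integrable (X Y : (x : M) → TangentSpace 𝓘(ℝ, E) x) (x : M)
    (hX : ContMDiffAt 𝓘(ℝ, E) (𝓘(ℝ, E).prod 𝓘(ℝ, E)) ∞ (fun y => (⟨y, X y⟩ : TangentBundle 𝓘(ℝ, E) M)) x)
    (hY : ContMDiffAt 𝓘(ℝ, E) (𝓘(ℝ, E).prod 𝓘(ℝ, E)) ∞ (fun y => (⟨y, Y y⟩ : TangentBundle 𝓘(ℝ, E) M)) x) :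
    VectorField.mlieBracket 𝓘(ℝ, E) (fun y => toFun y (X y)) (fun y => toFun y (Y y)) x
      - toFun x (VectorField.mlieBracket 𝓘(ℝ, E) (fun y => toFun y (X y)) Y x)
      - toFun x (VectorField.mlieBracket 𝓘(ℝ, E) X (fun y => toFun y (Y y)) x)
      - VectorField.mlieBracket 𝓘(ℝ, E) X Y x = 0

/-- A hypercomplex structure: complex structures with `IJ = -JI = K`. -/
structure HypercomplexStructure where
  I : ComplexStructure E M
  J : ComplexStructure E M
  K : ComplexStructure E M
  IJ (x : M) : I.toFun x ∘L J.toFun x = K.toFun x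
  JI (x : M) : J.toFun x ∘L I.toFun x = -K.toFun x

variable {E M}

/-- A hyperhermitian metric: a smooth Riemannian metric for which `I`, `J`, `K` are isometries. -/
structure HyperhermitianMetric (𝓗 : HypercomplexStructure E M) extends
    ContMDiffRiemannianMetric 𝓘(ℝ, E) ∞ E (fun x : M => TangentSpace 𝓘(ℝ, E) x) where
  hermI (x : M) (v w : TangentSpace 𝓘(ℝ, E) x) :
    inner x (𝓗.I.toFun x v) (𝓗.I.toFun x w) = inner x v w
  hermJ (x : M) (v w : TangentSpace 𝓘(ℝ, E) x) :
    inner x (𝓗.J.toFun x v) (𝓗.J.toFun x w) = inner x v w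
  hermK (x : M) (v w : TangentSpace 𝓘(ℝ, E) x) :
    inner x (𝓗.K.toFun x v) (𝓗.K.toFun x w) = inner x v w

variable {𝓗 : HypercomplexStructure E M}

/-- The map `X ↦ g(LX, ·)` for an endomorphism field `L`. -/
def fundamentalMap (g : HyperhermitianMetric 𝓗) (L : ComplexStructure E M) (x : M) :
    TangentSpace 𝓘(ℝ, E) x →L[ℝ] TangentSpace 𝓘(ℝ, E) x →L[ℝ] ℝ :=
  g.inner x ∘L L.toFun x

theorem fundamentalMap_self (g : HyperhermitianMetric 𝓗) (L : ComplexStructure E M)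
    (hL : ∀ (x : M) (v w : TangentSpace 𝓘(ℝ, E) x),
      g.inner x (L.toFun x v) (L.toFun x w) = g.inner x v w)
    (x : M) (v : TangentSpace 𝓘(ℝ, E) x) : fundamentalMap g L x v v = 0 := by
  have h1 := hL x (L.toFun x v) v
  rw [L.sq, map_neg, _root_.neg_apply, g.symm x v] at h1
  change g.inner x (L.toFun x v) v = 0
  linarith

theorem fundamentalMap_continuous (g : HyperhermitianMetric 𝓗) (L : ComplexStructure E M) (x : M) :
    Continuous fun p : TangentSpace 𝓘(ℝ, E) x × TangentSpace 𝓘(ℝ, E) x =>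
      fundamentalMap g L x p.1 p.2 := by
  let f : E →L[ℝ] E →L[ℝ] ℝ := fundamentalMap g L x
  exact (f.continuous.comp continuous_fst).clm_apply continuous_snd

/-- The fundamental form `σ_L(X, Y) = g(LX, Y)` of a complex structure `L` for which `g` is
Hermitian. -/
def fundamentalForm (g : HyperhermitianMetric 𝓗) (L : ComplexStructure E M)
    (hL : ∀ (x : M) (v w : TangentSpace 𝓘(ℝ, E) x),
      g.inner x (L.toFun x v) (L.toFun x w) = g.inner x v w)
    (x : M) : TangentSpace 𝓘(ℝ, E) x [⋀^Fin 2]→L[ℝ] ℝ :=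
  twoForm (fundamentalMap g L x) (fundamentalMap_self g L hL x) (fundamentalMap_continuous g L x)

/-- The HKT condition `d^c_I σ_I = d^c_J σ_J = d^c_K σ_K`; the fundamental forms are of
type `(1,1)`. -/
def HyperhermitianMetric.IsHKT (g : HyperhermitianMetric 𝓗) : Prop :=
  dcOperator 𝓗.I.toFun 1 1 (fundamentalForm g 𝓗.I g.hermI) =
      dcOperator 𝓗.J.toFun 1 1 (fundamentalForm g 𝓗.J g.hermJ) ∧
    dcOperator 𝓗.J.toFun 1 1 (fundamentalForm g 𝓗.J g.hermJ) =
      dcOperator 𝓗.K.toFun 1 1 (fundamentalForm g 𝓗.K g.hermK)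

end Hypercomplex

/-! ### The twistor space -/

section Twistor

/-- The unit sphere of `ℝ³`. -/
abbrev UnitSphere2 : Type := Metric.sphere (0 : EuclideanSpace ℝ (Fin 3)) 1

/-- The cross product `v ↦ a × v` on Euclidean 3-space. -/
def euclideanCross (a : EuclideanSpace ℝ (Fin 3)) :
    EuclideanSpace ℝ (Fin 3) →ₗ[ℝ] EuclideanSpace ℝ (Fin 3) :=
  (WithLp.linearEquiv 2 ℝ (Fin 3 → ℝ)).symm.toLinearMap ∘ₗ
    crossProduct (WithLp.ofLp a) ∘ₗ (WithLp.linearEquiv 2 ℝ (Fin 3 → ℝ)).toLinearMap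

theorem euclideanCross_mem (a v : EuclideanSpace ℝ (Fin 3)) :
    euclideanCross a v ∈ (ℝ ∙ a)ᗮ := by
  rw [Submodule.mem_orthogonal_singleton_iff_inner_right]
  simp [euclideanCross, PiLp.inner_apply, Fin.sum_univ_three, crossProduct]
  ring

/-- The tangent plane of the sphere at `a`, identified with `a^⊥ ⊆ ℝ³` through the differential of
the inclusion. -/
def sphereTangentEquiv (a : UnitSphere2) :
    TangentSpace (𝓡 2) a ≃ₗ[ℝ] (ℝ ∙ (a : EuclideanSpace ℝ (Fin 3)))ᗮ :=
  haveI := Fact.mk (@finrank_euclideanSpace_fin ℝ _ (2 + 1))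
  (LinearEquiv.ofInjective
      (mvfderiv (𝓡 2) (fun b : UnitSphere2 => (b : EuclideanSpace ℝ (Fin 3))) a).toLinearMap
      (injective_mvfderiv_subtypeVal_sphere a)).trans
    (LinearEquiv.ofEq _ _ (range_mvfderiv_subtypeVal a))

instance (a : UnitSphere2) : FiniteDimensional ℝ (TangentSpace (𝓡 2) a) :=
  inferInstanceAs (FiniteDimensional ℝ (EuclideanSpace ℝ (Fin 2)))

instance (a : UnitSphere2) : T2Space (TangentSpace (𝓡 2) a) :=
  inferInstanceAs (T2Space (EuclideanSpace ℝ (Fin 2)))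

/-- The complex structure of the 2-sphere: `v ↦ a × v` on the tangent plane `a^⊥`. -/
def sphereComplexStructure (a : UnitSphere2) :
    TangentSpace (𝓡 2) a →L[ℝ] TangentSpace (𝓡 2) a :=
  LinearMap.toContinuousLinearMap
    ((sphereTangentEquiv a).symm.toLinearMap ∘ₗ
      (euclideanCross a).restrict (fun v _ => euclideanCross_mem a v) ∘ₗ
      (sphereTangentEquiv a).toLinearMap)

variable {E : Type*} [NormedAddCommGroup E] [NormedSpace ℝ E]
  {M : Type*} [TopologicalSpace M] [ChartedSpace E M] [IsManifold 𝓘(ℝ, E) ∞ M]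

/-- The complex structure `I_a = a₀ I + a₁ J + a₂ K` at a point. -/
def HypercomplexStructure.structureAt (𝓗 : HypercomplexStructure E M) (a : UnitSphere2) (x : M) :
    TangentSpace 𝓘(ℝ, E) x →L[ℝ] TangentSpace 𝓘(ℝ, E) x :=
  (a.1 0) • 𝓗.I.toFun x + (a.1 1) • 𝓗.J.toFun x + (a.1 2) • 𝓗.K.toFun x

/-- The tautological complex structure `(I_a, I_{S²})` on the twistor space `M × S²`. -/
def HypercomplexStructure.twistorStructure (𝓗 : HypercomplexStructure E M) (z : M × UnitSphere2) :
    TangentSpace (𝓘(ℝ, E).prod (𝓡 2)) z →L[ℝ] TangentSpace (𝓘(ℝ, E).prod (𝓡 2)) z :=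
  ContinuousLinearMap.prodMap (𝓗.structureAt z.2 z.1) (sphereComplexStructure z.2)

/-- The section `s_a(x) = (x, a)` of the projection `M × S² → S²`. -/
def twistorSection (a : UnitSphere2) (x : M) : M × UnitSphere2 := (x, a)

variable {𝓗 : HypercomplexStructure E M}

/-- The bivector `P_I` dual to the fundamental form of `I`. -/
def HyperhermitianMetric.bivectorI (g : HyperhermitianMetric 𝓗) (x : M) :
    Bivector (TangentSpace 𝓘(ℝ, E) x) :=
  dualBivector (fundamentalMap g 𝓗.I x) (fundamentalMap_self g 𝓗.I g.hermI x)

/-- The bivector field on `M × S²` whose value at `(x, a)` is the `(2,0)`-component, for the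
tautological complex structure, of `(s_a)_* P_I`. -/
def HyperhermitianMetric.twistorBivector (g : HyperhermitianMetric 𝓗) (z : M × UnitSphere2) :
    Bivector (TangentSpace (𝓘(ℝ, E).prod (𝓡 2)) z) :=
  ((g.bivectorI z.1).pushforward
    (W := TangentSpace (𝓘(ℝ, E).prod (𝓡 2)) (twistorSection z.2 z.1))
    (mfderiv 𝓘(ℝ, E) (𝓘(ℝ, E).prod (𝓡 2)) (twistorSection z.2) z.1)).component20
    (𝓗.twistorStructure z)

end Twistor

end

/-!
The statement is local on `M`, and both conditions only involve the 1-jet at a point of `I`, `J`,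
`K` and `g`, read in a chart (`HyperhermitianJet`).

The linear connection of Obata, `HyperhermitianJet.obata`, is torsion-free because the Nijenhuis
tensors vanish, and it preserves `I`, `J`, `K`. Let `D` be the covariant derivative of `g` for it.
Then `dω_L` is the cyclic sum of `D_u g(L v, w)`; as this has type `(2,1) + (1,2)`, the form
`d^c_L ω_L` is a constant multiple of `dω_L(L·, L·, L·)`, which is minus the cyclic sum `S_LL` of
`D_{L u} g(v, L w)`. So `g` is HKT if and only if `S_II = S_JJ = S_KK`
(`HyperhermitianMetric.isHKT_iff_jet`, `HyperhermitianJet.isHKT_iff`).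

On the other side, the twistor bivector at `(x, a)` is horizontal, and equal to
`c_I P_I + c_J P_J + c_K P_K` for a vector `c = c(a) ∈ ℂ³` with `c · c = 0`
(`dualBivector_component20`, `twistorCoeff_isotropic`). Being horizontal, it is never differentiated
in the direction of the sphere when it is bracketed with itself, so its Schouten square at `(x, a)`
is that of `∑ c_L P_L` on `M` with constant `c`. On the covectors dual to `u, v, w` that square is
`2 ∑ c_L c_N S_LN`, where `S_LN` is the cyclic sum of `D_{L u} g(v, N w)`
(`HyperhermitianMetric.schoutenBracket_twistorBivector`, `HyperhermitianJet.schoutenSq_eq`). The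
mixed terms `S_IJ + S_JI`, `S_JK + S_KJ`, `S_IK + S_KI` are differences of `S_II`, `S_JJ`, `S_KK`
with one argument rotated (`HyperhermitianJet.cyclicCovMetric_mixed`), so that the square vanishes
if `g` is HKT and `c · c = 0`
(`HyperhermitianJet.IsHKT.schoutenSq_eq_zero`). Conversely, the real part of the square at the
points `a = J` and `a = K` of the sphere, on real covectors, gives multiples of `S_II - S_KK` and
`S_II - S_JJ` (`HyperhermitianJet.isHKT_of_schoutenSq`).
-/

noncomputable section

/-! ### One-jets of hyperhermitian structures -/

section Jet

/-- The 1-jet at a point of a hypercomplex structure and a hyperhermitian metric on an open subset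
of a vector space `E`: the values `I, J, K, g`, their derivatives `dI, dJ, dK, dg` (with the
direction of differentiation as first argument), the algebraic identities between them, their
derivatives, and the vanishing of the Nijenhuis tensors. -/
structure HyperhermitianJet (E : Type*) [NormedAddCommGroup E] [NormedSpace ℝ E] where
  (I J K : E →L[ℝ] E)
  (dI dJ dK : E →L[ℝ] E →L[ℝ] E)
  g : E →L[ℝ] E →L[ℝ] ℝ
  dg : E →L[ℝ] E →L[ℝ] E →L[ℝ] ℝ
  II (v : E) : I (I v) = -v
  JJ (v : E) : J (J v) = -v
  IJ (v : E) : I (J v) = K v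
  JI (v : E) : J (I v) = -K v
  dI_I (w v : E) : dI w (I v) + I (dI w v) = 0
  dJ_J (w v : E) : dJ w (J v) + J (dJ w v) = 0
  dI_J (w v : E) : dI w (J v) + I (dJ w v) = dK w v
  dJ_I (w v : E) : dJ w (I v) + J (dI w v) = -dK w v
  nijI (u v : E) : dI (I u) v - dI (I v) u + I (dI v u) - I (dI u v) = 0
  nijJ (u v : E) : dJ (J u) v - dJ (J v) u + J (dJ v u) - J (dJ u v) = 0
  nijK (u v : E) : dK (K u) v - dK (K v) u + K (dK v u) - K (dK u v) = 0
  g_symm (u v : E) : g u v = g v u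
  gI (u v : E) : g (I u) v = -g u (I v)
  gJ (u v : E) : g (J u) v = -g u (J v)
  gK (u v : E) : g (K u) v = -g u (K v)
  dg_symm (w u v : E) : dg w u v = dg w v u
  dgI (w u v : E) : dg w (I u) v + g (dI w u) v = -(dg w u (I v) + g u (dI w v))
  dgJ (w u v : E) : dg w (J u) v + g (dJ w u) v = -(dg w u (J v) + g u (dJ w v))
  dgK (w u v : E) : dg w (K u) v + g (dK w u) v = -(dg w u (K v) + g u (dK w v))

namespace HyperhermitianJet

variable {E : Type*} [NormedAddCommGroup E] [NormedSpace ℝ E] (j : HyperhermitianJet E)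

/-- The Christoffel symbol of the Obata connection, the torsion-free connection for which `I`, `J`
and `K` are parallel. -/
def obata (u v : E) : E :=
  (1 / 2 : ℝ) • (-j.I (j.dI v u) - j.J (j.dJ u v) + j.K (j.dJ (j.I u) v) - j.K (j.dI (j.J v) u))

theorem IK (v : E) : j.I (j.K v) = -j.J v := by rw [← j.IJ, j.II]

theorem KJ (v : E) : j.K (j.J v) = -j.I v := by rw [← j.IJ, j.JJ, map_neg]

theorem JK (v : E) : j.J (j.K v) = j.I v := by
  have h := j.JI (j.J v)
  rw [j.IJ, j.KJ, neg_neg] at h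
  exact h

theorem KI (v : E) : j.K (j.I v) = j.J v := by
  rw [← j.IJ, j.JI, map_neg, j.IK, neg_neg]

theorem KK (v : E) : j.K (j.K v) = -v := by rw [← j.IJ (j.K v), j.JK, j.II]

theorem dJ_eq_obata (u v : E) : j.dJ u v = j.J (j.obata u v) - j.obata u (j.J v) := by
  have h1 := congrArg j.J (j.dJ_J u v)
  have h2 := congrArg j.K (j.dJ_J (j.I u) v)
  simp only [obata, map_smul, map_add, map_sub, map_neg, j.JI, j.JJ, j.JK, j.KJ, map_zero,
    _root_.neg_apply] at *
  linear_combination (norm := module) -(1 / 2 : ℝ) • h1 + (1 / 2 : ℝ) • h2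

theorem dI_apply_I (w v : E) : j.dI w (j.I v) = -j.I (j.dI w v) :=
  eq_neg_of_add_eq_zero_left (j.dI_I w v)

theorem dJ_apply_J (w v : E) : j.dJ w (j.J v) = -j.J (j.dJ w v) :=
  eq_neg_of_add_eq_zero_left (j.dJ_J w v)

theorem dI_apply_K (w v : E) : j.dI w (j.K v) = -j.I (j.dI w (j.J v)) := by
  rw [← j.IJ, j.dI_apply_I]

theorem dJ_apply_I (w v : E) :
    j.dJ w (j.I v) = -j.J (j.dI w v) - (j.dI w (j.J v) + j.I (j.dJ w v)) := by
  rw [j.dI_J, eq_sub_iff_add_eq', ← sub_eq_zero]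
  linear_combination (norm := module) j.dJ_I w v

theorem dI_eq_obata (u v : E) : j.dI u v = j.I (j.obata u v) - j.obata u (j.I v) := by
  have h1 := congrArg j.I (j.nijI u v)
  have h2 := congrArg j.K (j.nijI u (j.J v))
  simp only [obata, map_smul, map_add, map_sub, map_neg, j.II, j.JJ, j.IJ, j.JI, j.KJ, j.KI,
    j.IK, map_zero, j.dJ_apply_I, _root_.neg_apply] at *
  linear_combination (norm := module) (1 / 2 : ℝ) • h1 - (1 / 2 : ℝ) • h2

theorem obata_comm (u v : E) : j.obata u v = j.obata v u := by
  have h1 := j.nijK (j.I u) (j.I v)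
  have h2 := j.nijI (j.I u) (j.I v)
  have h3 := j.nijJ (j.J u) (j.J v)
  simp only [obata, map_add, map_sub, map_neg, j.II, j.JJ, j.IJ, j.JI, j.KI, j.KK,
    ← j.dI_J, j.dI_apply_I, j.dJ_apply_J, j.dJ_apply_I, j.dI_apply_K,
    _root_.neg_apply] at *
  linear_combination (norm := module) (1 / 2 : ℝ) • (h2 - h1 - h3)

theorem dK_eq_obata (u v : E) : j.dK u v = j.K (j.obata u v) - j.obata u (j.K v) := by
  rw [← j.dI_J, j.dI_eq_obata, j.dJ_eq_obata, map_sub, j.IJ, j.IJ]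
  abel

/-- The covariant derivative of the metric with respect to the Obata connection. -/
def covMetric (w u v : E) : ℝ := j.dg w u v - j.g (j.obata w u) v - j.g u (j.obata w v)

theorem covMetric_symm (w u v : E) : j.covMetric w u v = j.covMetric w v u := by
  simp only [covMetric, j.dg_symm w u v, j.g_symm _ v, j.g_symm u]
  ring

theorem obata_neg_left (u v : E) : j.obata (-u) v = -j.obata u v := by
  simp only [obata, map_neg, _root_.neg_apply]
  module

theorem obata_neg_right (u v : E) : j.obata u (-v) = -j.obata u v := by
  simp only [obata, map_neg, _root_.neg_apply]
  module

set_option synthInstance.maxHeartbeats 400000 in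
theorem covMetric_neg_left (w u v : E) : j.covMetric (-w) u v = -j.covMetric w u v := by
  have h : j.dg (-w) = -j.dg w := map_neg j.dg w
  simp only [covMetric, h, obata_neg_left, map_neg, _root_.neg_apply]
  ring

theorem covMetric_neg_right (w u v : E) : j.covMetric w u (-v) = -j.covMetric w u v := by
  simp only [covMetric, obata_neg_right, map_neg]
  ring

section Generic

/-! The next lemmas apply to each of the three complex structures `L = I, J, K`. -/

variable {L : E →L[ℝ] E} {dL : E →L[ℝ] E →L[ℝ] E}

theorem covMetric_skew (hd : ∀ u v, dL u v = L (j.obata u v) - j.obata u (L v))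
    (hg : ∀ u v, j.g (L u) v = -j.g u (L v))
    (hdg : ∀ w u v, j.dg w (L u) v + j.g (dL w u) v = -(j.dg w u (L v) + j.g u (dL w v)))
    (w u v : E) : j.covMetric w (L u) v = -j.covMetric w u (L v) := by
  have h1 := hdg w u v
  simp only [hd, map_sub, _root_.sub_apply, hg] at h1
  simp only [covMetric, hg]
  linarith

theorem dg_add_eq_covMetric (hd : ∀ u v, dL u v = L (j.obata u v) - j.obata u (L v))
    (hg : ∀ u v, j.g (L u) v = -j.g u (L v)) (u v w : E) :
    j.dg u (L v) w + j.g (dL u v) w =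
      j.covMetric u (L v) w - j.g v (L (j.obata u w)) - j.g (j.obata u v) (L w) := by
  simp only [covMetric, hd, map_sub, _root_.sub_apply, hg]
  ring

/-- The exterior derivative of the fundamental form `g(L·, ·)`. -/
def extDerivForm (L : E →L[ℝ] E) (dL : E →L[ℝ] E →L[ℝ] E) (u v w : E) : ℝ :=
  (j.dg u (L v) w + j.g (dL u v) w) - (j.dg v (L u) w + j.g (dL v u) w) +
    (j.dg w (L u) v + j.g (dL w u) v)

/-- The cyclic sum of `(∇_{Nu} g)(v, Mw)` for the Obata connection `∇`. -/
def cyclicCovMetric (N M : E →L[ℝ] E) (u v w : E) : ℝ :=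
  j.covMetric (N u) v (M w) + j.covMetric (N v) w (M u) + j.covMetric (N w) u (M v)

theorem extDerivForm_eq (hd : ∀ u v, dL u v = L (j.obata u v) - j.obata u (L v))
    (hg : ∀ u v, j.g (L u) v = -j.g u (L v))
    (hdg : ∀ w u v, j.dg w (L u) v + j.g (dL w u) v = -(j.dg w u (L v) + j.g u (dL w v)))
    (u v w : E) : j.extDerivForm L dL u v w =
      -(j.covMetric u v (L w) + j.covMetric v w (L u) + j.covMetric w u (L v)) := by
  simp only [extDerivForm, j.dg_add_eq_covMetric hd hg, j.covMetric_skew hd hg hdg,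
    j.obata_comm v u, j.obata_comm w u, j.obata_comm w v]
  have h1 := j.covMetric_skew hd hg hdg v u w
  have h2 := j.covMetric_symm v (L u) w
  have h3 := hg (j.obata u v) w
  have h4 := hg (j.obata u w) v
  have h5 := hg (j.obata v w) u
  simp only [j.g_symm (L _)] at h3 h4 h5
  linarith

theorem extDerivForm_rotate (hL : ∀ v, L (L v) = -v)
    (hd : ∀ u v, dL u v = L (j.obata u v) - j.obata u (L v))
    (hg : ∀ u v, j.g (L u) v = -j.g u (L v))
    (hdg : ∀ w u v, j.dg w (L u) v + j.g (dL w u) v = -(j.dg w u (L v) + j.g u (dL w v)))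
    (u v w : E) : j.extDerivForm L dL (L u) (L v) (L w) = -j.cyclicCovMetric L L u v w := by
  simp only [j.extDerivForm_eq hd hg hdg, cyclicCovMetric, j.covMetric_skew hd hg hdg, hL,
    map_neg, j.covMetric_neg_right]
  ring

/-- The exterior derivative of the fundamental form of `L` has type `(2,1) + (1,2)`. -/
theorem extDerivForm_type (hL : ∀ v, L (L v) = -v)
    (hd : ∀ u v, dL u v = L (j.obata u v) - j.obata u (L v))
    (hg : ∀ u v, j.g (L u) v = -j.g u (L v))
    (hdg : ∀ w u v, j.dg w (L u) v + j.g (dL w u) v = -(j.dg w u (L v) + j.g u (dL w v)))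
    (u v w : E) :
    j.extDerivForm L dL (L u) v w + j.extDerivForm L dL u (L v) w +
      j.extDerivForm L dL u v (L w) = j.extDerivForm L dL (L u) (L v) (L w) := by
  simp only [j.extDerivForm_rotate hL hd hg hdg, j.extDerivForm_eq hd hg hdg, cyclicCovMetric,
    j.covMetric_skew hd hg hdg, hL, j.covMetric_neg_right]
  have h1 := j.covMetric_symm u v w
  have h2 := j.covMetric_symm v w u
  have h3 := j.covMetric_symm w u v
  linarith

/-- The derivative of the bivector dual to `g(M·, ·)`, in the direction `N u` and on the covectors
`g(v, ·)` and `g(w, ·)`. -/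
def dualDeriv (N M : E →L[ℝ] E) (dM : E →L[ℝ] E →L[ℝ] E) (u v w : E) : ℝ :=
  j.dg (N u) v (M w) + j.g (dM (N u) v) w

/-- The cyclic sum of `dualDeriv`. -/
def cyclicDualDeriv (N M : E →L[ℝ] E) (dM : E →L[ℝ] E →L[ℝ] E) (u v w : E) : ℝ :=
  j.dualDeriv N M dM u v w + j.dualDeriv N M dM v w u + j.dualDeriv N M dM w u v

/-- In the Schouten bracket of the bivectors dual to two fundamental forms, the Christoffel symbols
of the Obata connection cancel. -/
theorem cyclicDualDeriv_add {N M : E →L[ℝ] E} {dN dM : E →L[ℝ] E →L[ℝ] E}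
    (hdN : ∀ u v, dN u v = N (j.obata u v) - j.obata u (N v))
    (hgN : ∀ u v, j.g (N u) v = -j.g u (N v))
    (hdM : ∀ u v, dM u v = M (j.obata u v) - j.obata u (M v))
    (hgM : ∀ u v, j.g (M u) v = -j.g u (M v)) (u v w : E) :
    j.cyclicDualDeriv N M dM u v w + j.cyclicDualDeriv M N dN u v w =
      j.cyclicCovMetric N M u v w + j.cyclicCovMetric M N u v w := by
  simp only [cyclicDualDeriv, dualDeriv, cyclicCovMetric, covMetric, hdN, hdM, map_sub,
    _root_.sub_apply, hgN, hgM, j.obata_comm (M _) (N _), j.g_symm (j.obata (N _) (M _)),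
    j.g_symm (j.obata (N _) _) (M _)]
  ring

end Generic

/-- The three complex structures as a family. -/
def str : Fin 3 → E →L[ℝ] E := ![j.I, j.J, j.K]

/-- The derivatives of the three complex structures as a family. -/
def dstr : Fin 3 → E →L[ℝ] E →L[ℝ] E := ![j.dI, j.dJ, j.dK]

theorem str_str (i : Fin 3) (v : E) : j.str i (j.str i v) = -v := by
  fin_cases i
  exacts [j.II v, j.JJ v, j.KK v]

theorem dstr_eq_obata (i : Fin 3) (u v : E) :
    j.dstr i u v = j.str i (j.obata u v) - j.obata u (j.str i v) := by
  fin_cases i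
  exacts [j.dI_eq_obata u v, j.dJ_eq_obata u v, j.dK_eq_obata u v]

theorem g_str (i : Fin 3) (u v : E) : j.g (j.str i u) v = -j.g u (j.str i v) := by
  fin_cases i
  exacts [j.gI u v, j.gJ u v, j.gK u v]

theorem dg_str (i : Fin 3) (w u v : E) :
    j.dg w (j.str i u) v + j.g (j.dstr i w u) v =
      -(j.dg w u (j.str i v) + j.g u (j.dstr i w v)) := by
  fin_cases i
  exacts [j.dgI w u v, j.dgJ w u v, j.dgK w u v]

/-- The HKT condition on a 1-jet: `dω_L(L·, L·, L·)` is the same for `L = I, J, K`. -/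
def IsHKT : Prop :=
  ∀ i k : Fin 3, ∀ u v w : E,
    j.extDerivForm (j.str i) (j.dstr i) (j.str i u) (j.str i v) (j.str i w) =
      j.extDerivForm (j.str k) (j.dstr k) (j.str k u) (j.str k v) (j.str k w)

theorem isHKT_iff : j.IsHKT ↔ ∀ u v w : E,
    j.cyclicCovMetric j.I j.I u v w = j.cyclicCovMetric j.J j.J u v w ∧
    j.cyclicCovMetric j.I j.I u v w = j.cyclicCovMetric j.K j.K u v w := by
  simp only [IsHKT, j.extDerivForm_rotate (j.str_str _) (j.dstr_eq_obata _) (j.g_str _)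
    (j.dg_str _), neg_inj]
  refine ⟨fun h u v w => ⟨h 0 1 u v w, h 0 2 u v w⟩, fun h => ?_⟩
  have h' (i : Fin 3) (u v w : E) : j.cyclicCovMetric (j.str i) (j.str i) u v w =
      j.cyclicCovMetric j.I j.I u v w := by
    fin_cases i
    exacts [rfl, (h u v w).1.symm, (h u v w).2.symm]
  intro i k u v w
  rw [h' i, h' k]

/-- The Schouten square of the bivector `∑ c_L P_L`, where `P_L` is dual to `g(L·, ·)`, on the
covectors `g(u, ·)`, `g(v, ·)`, `g(w, ·)` (up to a factor `2`). -/
def schoutenSq (c : Fin 3 → ℂ) (u v w : E) : ℂ :=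
  ∑ i, ∑ k, c i * c k * (j.cyclicDualDeriv (j.str i) (j.str k) (j.dstr k) u v w : ℝ)

theorem schoutenSq_eq (c : Fin 3 → ℂ) (u v w : E) :
    j.schoutenSq c u v w =
      ∑ i, ∑ k, c i * c k * (j.cyclicCovMetric (j.str i) (j.str k) u v w : ℝ) := by
  have h (i k : Fin 3) : ((j.cyclicDualDeriv (j.str i) (j.str k) (j.dstr k) u v w : ℝ) : ℂ) +
      (j.cyclicDualDeriv (j.str k) (j.str i) (j.dstr i) u v w : ℝ) =
      (j.cyclicCovMetric (j.str i) (j.str k) u v w : ℝ) +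
      (j.cyclicCovMetric (j.str k) (j.str i) u v w : ℝ) := by
    exact_mod_cast j.cyclicDualDeriv_add (j.dstr_eq_obata i) (j.g_str i) (j.dstr_eq_obata k)
      (j.g_str k) u v w
  simp only [schoutenSq, Fin.sum_univ_three]
  linear_combination (c 0 ^ 2 / 2) * h 0 0 + (c 1 ^ 2 / 2) * h 1 1 + (c 2 ^ 2 / 2) * h 2 2 +
    c 0 * c 1 * h 0 1 + c 0 * c 2 * h 0 2 + c 1 * c 2 * h 1 2

theorem covMetric_I (w u v : E) : j.covMetric w (j.I u) v = -j.covMetric w u (j.I v) :=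
  j.covMetric_skew j.dI_eq_obata j.gI j.dgI w u v

theorem covMetric_J (w u v : E) : j.covMetric w (j.J u) v = -j.covMetric w u (j.J v) :=
  j.covMetric_skew j.dJ_eq_obata j.gJ j.dgJ w u v

theorem covMetric_K (w u v : E) : j.covMetric w (j.K u) v = -j.covMetric w u (j.K v) :=
  j.covMetric_skew j.dK_eq_obata j.gK j.dgK w u v

/-- The mixed brackets of the bivectors `P_I`, `P_J`, `P_K` are differences of the `d^c_L ω_L`,
evaluated with one argument rotated by the third complex structure. -/
theorem cyclicCovMetric_mixed (u v w : E) :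
    j.cyclicCovMetric j.I j.J u v w + j.cyclicCovMetric j.J j.I u v w =
        j.cyclicCovMetric j.J j.J (j.K u) v w - j.cyclicCovMetric j.I j.I (j.K u) v w ∧
    j.cyclicCovMetric j.J j.K u v w + j.cyclicCovMetric j.K j.J u v w =
        j.cyclicCovMetric j.K j.K (j.I u) v w - j.cyclicCovMetric j.J j.J (j.I u) v w ∧
    j.cyclicCovMetric j.I j.K u v w + j.cyclicCovMetric j.K j.I u v w =
        j.cyclicCovMetric j.I j.I (j.J u) v w - j.cyclicCovMetric j.K j.K (j.J u) v w := by
  simp only [cyclicCovMetric, j.covMetric_I, j.covMetric_J, j.covMetric_K, j.IJ, j.JI, j.JK, j.KJ,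
    j.KI, j.IK, j.covMetric_neg_left, j.covMetric_neg_right]
  refine ⟨?_, ?_, ?_⟩ <;> ring

theorem IsHKT.schoutenSq_eq_zero {j : HyperhermitianJet E} (h : j.IsHKT) {c : Fin 3 → ℂ}
    (hc : c 0 ^ 2 + c 1 ^ 2 + c 2 ^ 2 = 0) (u v w : E) : j.schoutenSq c u v w = 0 := by
  rw [isHKT_iff] at h
  obtain ⟨h1, h2, h3⟩ := j.cyclicCovMetric_mixed u v w
  rw [← (h _ _ _).1, sub_self] at h1
  rw [← (h _ _ _).2, ← (h _ _ _).1, sub_self] at h2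
  rw [← (h _ _ _).2, sub_self] at h3
  have h4 := (h u v w).1
  have h5 := (h u v w).2
  have e (x y : ℝ) (hxy : x + y = 0) : (x : ℂ) + y = 0 := by exact_mod_cast hxy
  rw [schoutenSq_eq]
  simp only [Fin.sum_univ_three, str, Matrix.cons_val]
  rw [← h4, ← h5]
  linear_combination c 0 * c 1 * e _ _ h1 + c 1 * c 2 * e _ _ h2 + c 0 * c 2 * e _ _ h3 +
    (j.cyclicCovMetric j.I j.I u v w : ℂ) * hc

/-- The Schouten squares at the two isotropic vectors `(1, 0, i)` and `(1, -i, 0)` determine the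
differences of the `d^c_L ω_L`. -/
theorem isHKT_of_schoutenSq {c d : Fin 3 → ℂ} (hc : c = ![1 / 2, 0, Complex.I / 2])
    (hd : d = ![1 / 2, -Complex.I / 2, 0]) (h1 : ∀ u v w, j.schoutenSq c u v w = 0)
    (h2 : ∀ u v w, j.schoutenSq d u v w = 0) : j.IsHKT := by
  rw [isHKT_iff]
  intro u v w
  have h3 := congrArg Complex.re (h1 u v w)
  have h4 := congrArg Complex.re (h2 u v w)
  simp [schoutenSq_eq, hc, hd, Fin.sum_univ_three, str] at h3 h4
  constructor <;> linarith

end HyperhermitianJet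

end Jet
end

noncomputable section

/-! ### Hyperhermitian structures in a chart -/

section Chart

set_option synthInstance.maxHeartbeats 400000

open Filter Topology

variable {E : Type*} [NormedAddCommGroup E] [NormedSpace ℝ E]
  {M : Type*} [TopologicalSpace M] [ChartedSpace E M] [IsManifold 𝓘(ℝ, E) ∞ M]

/-- The differential at `x` of the preferred chart at `x₀`, as a trivialization of the tangent
bundle. -/
def toModel (x₀ x : M) : TangentSpace 𝓘(ℝ, E) x →L[ℝ] E :=
  (trivializationAt E (TangentSpace 𝓘(ℝ, E)) x₀).continuousLinearMapAt ℝ x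

/-- The inverse of `toModel`. -/
def ofModel (x₀ x : M) : E →L[ℝ] TangentSpace 𝓘(ℝ, E) x :=
  (trivializationAt E (TangentSpace 𝓘(ℝ, E)) x₀).symmL ℝ x

variable {x₀ x : M} {y : E}

theorem toModel_ofModel (hx : x ∈ (chartAt E x₀).source) (v : E) :
    toModel x₀ x (ofModel x₀ x v) = v :=
  Trivialization.continuousLinearMapAt_symmL _ hx v

theorem ofModel_toModel (hx : x ∈ (chartAt E x₀).source) (v : TangentSpace 𝓘(ℝ, E) x) :
    ofModel x₀ x (toModel x₀ x v) = v :=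
  Trivialization.symmL_continuousLinearMapAt _ hx v

theorem mvfderiv_extChartAt (hx : x ∈ (chartAt E x₀).source) :
    mvfderiv 𝓘(ℝ, E) (extChartAt 𝓘(ℝ, E) x₀) x = toModel x₀ x :=
  (TangentBundle.continuousLinearMapAt_trivializationAt hx).symm

theorem mfderiv_extChartAt_symm (hy : y ∈ (extChartAt 𝓘(ℝ, E) x₀).target) :
    mfderiv 𝓘(ℝ, E) 𝓘(ℝ, E) (extChartAt 𝓘(ℝ, E) x₀).symm y =
      ofModel (E := E) x₀ ((extChartAt 𝓘(ℝ, E) x₀).symm y) := by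
  have hx : (extChartAt 𝓘(ℝ, E) x₀).symm y ∈ (chartAt E x₀).source := by
    rw [← extChartAt_source 𝓘(ℝ, E)]
    exact (extChartAt 𝓘(ℝ, E) x₀).map_target hy
  have h := TangentBundle.symmL_trivializationAt (𝕜 := ℝ) (I := 𝓘(ℝ, E)) hx
  rw [(extChartAt 𝓘(ℝ, E) x₀).right_inv hy, ModelWithCorners.range_eq_univ,
    mfderivWithin_univ] at h
  exact h.symm

theorem toModel_self (x₀ : M) (v : TangentSpace 𝓘(ℝ, E) x₀) : toModel x₀ x₀ v = v := by
  have h := mfderiv_extChartAt_self (I := 𝓘(ℝ, E)) (x := x₀)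
  have h2 := mvfderiv_extChartAt (mem_chart_source E x₀)
  rw [← h2]
  exact congrArg (fun f : E →L[ℝ] E => f v) h

theorem ofModel_self (x₀ : M) (v : E) : ofModel x₀ x₀ v = v := by
  have h := toModel_ofModel (mem_chart_source E x₀) v
  rwa [toModel_self] at h

/-- A field of endomorphisms, read in the preferred chart at `x₀`. -/
def modelEndo (L : (x : M) → TangentSpace 𝓘(ℝ, E) x →L[ℝ] TangentSpace 𝓘(ℝ, E) x) (x₀ x : M) :
    E →L[ℝ] E :=
  toModel x₀ x ∘L L x ∘L ofModel x₀ x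

/-- A field of bilinear forms, read in the preferred chart at `x₀`. -/
def modelForm (g : (x : M) → TangentSpace 𝓘(ℝ, E) x →L[ℝ] TangentSpace 𝓘(ℝ, E) x →L[ℝ] ℝ)
    (x₀ x : M) : E →L[ℝ] E →L[ℝ] ℝ :=
  ContinuousLinearMap.precomp ℝ (ofModel x₀ x) ∘L g x ∘L ofModel x₀ x

theorem ComplexStructure.contMDiffOn_modelEndo (L : ComplexStructure E M) (x₀ : M) :
    ContMDiffOn 𝓘(ℝ, E) 𝓘(ℝ, E →L[ℝ] E) ∞ (modelEndo L.toFun x₀) (chartAt E x₀).source := by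
  intro x hx
  have h := L.smooth x
  rw [Trivialization.contMDiffAt_section_iff (trivializationAt (E →L[ℝ] E)
    (fun x : M => TangentSpace 𝓘(ℝ, E) x →L[ℝ] TangentSpace 𝓘(ℝ, E) x) x₀) ⟨hx, hx⟩] at h
  exact h.contMDiffWithinAt

theorem contMDiffAt_ofModel (hx : x ∈ (chartAt E x₀).source) (v : E) :
    ContMDiffAt 𝓘(ℝ, E) (𝓘(ℝ, E).prod 𝓘(ℝ, E)) ∞
      (fun y => (⟨y, ofModel x₀ y v⟩ : TangentBundle 𝓘(ℝ, E) M)) x := by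
  rw [Trivialization.contMDiffAt_section_iff (trivializationAt E (TangentSpace 𝓘(ℝ, E)) x₀) hx]
  refine (contMDiffAt_const (c := v)).congr_of_eventuallyEq ?_
  filter_upwards [(chartAt E x₀).open_source.mem_nhds hx] with z hz
  have := toModel_ofModel hz v
  rw [toModel, Trivialization.continuousLinearMapAt_apply,
    Trivialization.coe_linearMapAt_of_mem _ hz] at this
  exact this

theorem HyperhermitianMetric.contMDiffOn_modelForm [FiniteDimensional ℝ E]
    {𝓗 : HypercomplexStructure E M} (g : HyperhermitianMetric 𝓗) (x₀ : M) (u v : E) :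
    ContMDiffOn 𝓘(ℝ, E) 𝓘(ℝ, ℝ) ∞ (fun x => modelForm g.inner x₀ x u v)
      (chartAt E x₀).source := by
  intro x hx
  have h : ContMDiffAt 𝓘(ℝ, E) (𝓘(ℝ, E).prod 𝓘(ℝ)) ∞
      (fun m ↦ TotalSpace.mk' ℝ (E := Bundle.Trivial M ℝ) m
        (g.inner m (ofModel x₀ m u) (ofModel x₀ m v))) x := by
    apply ContMDiffAt.clm_bundle_apply₂ (F₁ := E) (F₂ := E)
    · exact g.contMDiff.contMDiffAt
    · exact contMDiffAt_ofModel hx u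
    · exact contMDiffAt_ofModel hx v
  simp only [contMDiffAt_totalSpace] at h
  exact h.2.contMDiffWithinAt

theorem contDiffAt_comp_extChartAt_symm {F : Type*} [NormedAddCommGroup F] [NormedSpace ℝ F]
    {f : M → F} (hf : ContMDiffOn 𝓘(ℝ, E) 𝓘(ℝ, F) ∞ f (chartAt E x₀).source)
    (hy : y ∈ (extChartAt 𝓘(ℝ, E) x₀).target) :
    ContDiffAt ℝ ∞ (fun y => f ((extChartAt 𝓘(ℝ, E) x₀).symm y)) y := by
  have h := hf.comp (contMDiffOn_extChartAt_symm (n := ∞) (I := 𝓘(ℝ, E)) x₀)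
    (fun z hz => by
      rw [Set.mem_preimage, ← extChartAt_source 𝓘(ℝ, E)]
      exact (extChartAt 𝓘(ℝ, E) x₀).map_target hz)
  exact (contMDiffOn_iff_contDiffOn.1 h).contDiffAt ((isOpen_extChartAt_target x₀).mem_nhds hy)

omit [IsManifold 𝓘(ℝ, E) ∞ M] in
theorem eventually_extChartAt_symm_mem (x₀ : M) :
    ∀ᶠ y in 𝓝 (extChartAt 𝓘(ℝ, E) x₀ x₀), y ∈ (extChartAt 𝓘(ℝ, E) x₀).target ∧
      (extChartAt 𝓘(ℝ, E) x₀).symm y ∈ (chartAt E x₀).source := by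
  filter_upwards [(isOpen_extChartAt_target x₀).mem_nhds (mem_extChartAt_target x₀)] with y hy
  refine ⟨hy, ?_⟩
  rw [← extChartAt_source 𝓘(ℝ, E)]
  exact (extChartAt 𝓘(ℝ, E) x₀).map_target hy

theorem ComplexStructure.differentiableAt_modelEndo (L : ComplexStructure E M) (x₀ : M) :
    DifferentiableAt ℝ (fun y => modelEndo L.toFun x₀ ((extChartAt 𝓘(ℝ, E) x₀).symm y))
      (extChartAt 𝓘(ℝ, E) x₀ x₀) :=
  (contDiffAt_comp_extChartAt_symm (L.contMDiffOn_modelEndo x₀)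
    (mem_extChartAt_target x₀)).differentiableAt (by simp)

theorem HyperhermitianMetric.contMDiffOn_modelForm' [FiniteDimensional ℝ E]
    {𝓗 : HypercomplexStructure E M} (g : HyperhermitianMetric 𝓗) (x₀ : M) :
    ContMDiffOn 𝓘(ℝ, E) 𝓘(ℝ, E →L[ℝ] E →L[ℝ] ℝ) ∞ (modelForm g.inner x₀)
      (chartAt E x₀).source := by
  have h : ContDiffOn ℝ ∞ (fun y => modelForm g.inner x₀ ((extChartAt 𝓘(ℝ, E) x₀).symm y))
      (extChartAt 𝓘(ℝ, E) x₀).target := by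
    simp only [contDiffOn_clm_apply]
    intro u v y hy
    exact (contDiffAt_comp_extChartAt_symm (g.contMDiffOn_modelForm x₀ u v) hy).contDiffWithinAt
  have h2 := (contMDiffOn_iff_contDiffOn.2 h).comp
    (contMDiffOn_extChartAt (I := 𝓘(ℝ, E)) (x := x₀) (n := ∞))
    (fun x hx => (extChartAt 𝓘(ℝ, E) x₀).map_source (by rwa [extChartAt_source]))
  refine h2.congr fun x hx => ?_
  rw [Function.comp_apply, (extChartAt 𝓘(ℝ, E) x₀).left_inv (by rwa [extChartAt_source])]

theorem HyperhermitianMetric.differentiableAt_modelForm [FiniteDimensional ℝ E]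
    {𝓗 : HypercomplexStructure E M} (g : HyperhermitianMetric 𝓗) (x₀ : M) :
    DifferentiableAt ℝ (fun y => modelForm g.inner x₀ ((extChartAt 𝓘(ℝ, E) x₀).symm y))
      (extChartAt 𝓘(ℝ, E) x₀ x₀) :=
  (contDiffAt_comp_extChartAt_symm (g.contMDiffOn_modelForm' x₀)
    (mem_extChartAt_target x₀)).differentiableAt (by simp)

/-- The Lie bracket of two vector fields at the base point of a chart, in terms of their
expressions `V'`, `W'` in this chart. -/
theorem mlieBracket_eq_fderiv {V W : (x : M) → TangentSpace 𝓘(ℝ, E) x} {V' W' : E → E}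
    (hV : ∀ᶠ y in 𝓝 (extChartAt 𝓘(ℝ, E) x₀ x₀),
      V ((extChartAt 𝓘(ℝ, E) x₀).symm y) = ofModel x₀ _ (V' y))
    (hW : ∀ᶠ y in 𝓝 (extChartAt 𝓘(ℝ, E) x₀ x₀),
      W ((extChartAt 𝓘(ℝ, E) x₀).symm y) = ofModel x₀ _ (W' y)) :
    VectorField.mlieBracket 𝓘(ℝ, E) V W x₀ =
      fderiv ℝ W' (extChartAt 𝓘(ℝ, E) x₀ x₀) (V' (extChartAt 𝓘(ℝ, E) x₀ x₀)) -
        fderiv ℝ V' (extChartAt 𝓘(ℝ, E) x₀ x₀) (W' (extChartAt 𝓘(ℝ, E) x₀ x₀)) := by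
  have key {X : (x : M) → TangentSpace 𝓘(ℝ, E) x} {X' : E → E}
      (hX : ∀ᶠ y in 𝓝 (extChartAt 𝓘(ℝ, E) x₀ x₀),
        X ((extChartAt 𝓘(ℝ, E) x₀).symm y) = ofModel x₀ _ (X' y)) :
      VectorField.mpullback 𝓘(ℝ, E) 𝓘(ℝ, E) (extChartAt 𝓘(ℝ, E) x₀).symm X
        =ᶠ[𝓝 (extChartAt 𝓘(ℝ, E) x₀ x₀)] X' := by
    filter_upwards [hX, eventually_extChartAt_symm_mem x₀] with y hy hy'
    rw [VectorField.mpullback_apply, hy, mfderiv_extChartAt_symm hy'.1]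
    let e : E ≃L[ℝ] TangentSpace 𝓘(ℝ, E) ((extChartAt 𝓘(ℝ, E) x₀).symm y) :=
      ContinuousLinearEquiv.equivOfInverse (ofModel x₀ _) (toModel x₀ _) (toModel_ofModel hy'.2)
        (ofModel_toModel hy'.2)
    have he : ofModel x₀ ((extChartAt 𝓘(ℝ, E) x₀).symm y) = (e : E →L[ℝ] _) := rfl
    rw [he]
    erw [ContinuousLinearMap.inverse_equiv]
    exact e.symm_apply_apply _
  have hbr := (key hV).lieBracket_vectorField_eq (𝕜 := ℝ) (key hW)
  rw [VectorField.lieBracket_eq (V := V')] at hbr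
  have hinv (v : E) : (mfderiv 𝓘(ℝ, E) 𝓘(ℝ, E) (extChartAt 𝓘(ℝ, E) x₀) x₀).inverse v = v := by
    rw [mfderiv_extChartAt_self]
    exact congrArg (fun f : E →L[ℝ] E => f v) ContinuousLinearMap.inverse_id
  rw [← VectorField.mlieBracketWithin_univ, VectorField.mlieBracketWithin_apply]
  simp only [ModelWithCorners.range_eq_univ, VectorField.mpullbackWithin_univ, Set.preimage_univ,
    Set.inter_univ]
  exact (hinv _).trans ((congrFun (VectorField.lieBracketWithin_univ (E := E)) _).trans hbr)

theorem ComplexStructure.nijenhuis_modelEndo (L : ComplexStructure E M) (x₀ : M)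
    {dL : E →L[ℝ] E →L[ℝ] E}
    (hL : HasFDerivAt (fun y => modelEndo L.toFun x₀ ((extChartAt 𝓘(ℝ, E) x₀).symm y)) dL
      (extChartAt 𝓘(ℝ, E) x₀ x₀)) (u v : E) :
    dL (modelEndo L.toFun x₀ x₀ u) v - dL (modelEndo L.toFun x₀ x₀ v) u +
      modelEndo L.toFun x₀ x₀ (dL v u) - modelEndo L.toFun x₀ x₀ (dL u v) = 0 := by
  have hc (w : E) : ∀ᶠ y in 𝓝 (extChartAt 𝓘(ℝ, E) x₀ x₀),
      (fun x => ofModel (E := E) x₀ x w) ((extChartAt 𝓘(ℝ, E) x₀).symm y) =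
        ofModel x₀ _ ((fun _ => w) y) := Eventually.of_forall fun _ => rfl
  have hl (w : E) : ∀ᶠ y in 𝓝 (extChartAt 𝓘(ℝ, E) x₀ x₀),
      (fun x => L.toFun x (ofModel (E := E) x₀ x w)) ((extChartAt 𝓘(ℝ, E) x₀).symm y) =
        ofModel x₀ _ ((fun y => modelEndo L.toFun x₀ ((extChartAt 𝓘(ℝ, E) x₀).symm y) w) y) := by
    filter_upwards [eventually_extChartAt_symm_mem x₀] with y hy
    exact (ofModel_toModel hy.2 _).symm
  have hd (w : E) := (hL.clm_apply (hasFDerivAt_const w _)).fderiv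
  have hs (w : E) := contMDiffAt_ofModel (mem_chart_source E x₀) w
  have h := L.integrable _ _ x₀ (hs u) (hs v)
  rw [mlieBracket_eq_fderiv (hl u) (hl v), mlieBracket_eq_fderiv (hl u) (hc v),
    mlieBracket_eq_fderiv (hc u) (hl v), mlieBracket_eq_fderiv (hc u) (hc v)] at h
  have hself (w : E) : L.toFun x₀ w = modelEndo L.toFun x₀ x₀ w := by
    simp only [modelEndo, ContinuousLinearMap.comp_apply]
    rw [toModel_self, ofModel_self]
  simp only [hd, (extChartAt 𝓘(ℝ, E) x₀).left_inv (mem_extChartAt_source x₀)] at h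
  simp only [fderiv_fun_const, hself] at h
  have h0 : dL (modelEndo L.toFun x₀ x₀ u) v - dL (modelEndo L.toFun x₀ x₀ v) u -
      modelEndo L.toFun x₀ x₀ (0 - dL v u) - modelEndo L.toFun x₀ x₀ (dL u v - 0) -
        (0 - 0) = 0 := by
    refine Eq.trans ?_ h
    simp only [ContinuousLinearMap.comp_zero, zero_add, Pi.zero_apply,
      ContinuousLinearMap.flip_apply]
    rfl
  rw [← h0]
  simp

/-- A pointwise identity `A B = C` of endomorphism fields, differentiated. -/
theorem hasFDerivAt_endo_comp {A B C : E → E →L[ℝ] E} {dA dB dC : E →L[ℝ] E →L[ℝ] E}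
    (hA : HasFDerivAt A dA y) (hB : HasFDerivAt B dB y) (hC : HasFDerivAt C dC y)
    (h : ∀ᶠ z in 𝓝 y, ∀ v, A z (B z v) = C z v) (w v : E) :
    dA w (B y v) + A y (dB w v) = dC w v := by
  have hv := hasFDerivAt_const (𝕜 := ℝ) v y
  have h1 := (hA.clm_apply (hB.clm_apply hv)).congr_of_eventuallyEq
    (h.mono fun z hz => (hz v).symm)
  have h2 := congrArg (fun f => f w) (h1.unique (hC.clm_apply hv))
  simpa [add_comm] using h2

/-- The skew-symmetry of an endomorphism field with respect to a field of bilinear forms,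
differentiated. -/
theorem hasFDerivAt_skew {A : E → E →L[ℝ] E} {g : E → E →L[ℝ] E →L[ℝ] ℝ}
    {dA : E →L[ℝ] E →L[ℝ] E} {dg : E →L[ℝ] E →L[ℝ] E →L[ℝ] ℝ}
    (hA : HasFDerivAt A dA y) (hg : HasFDerivAt g dg y)
    (h : ∀ᶠ z in 𝓝 y, ∀ u v, g z (A z u) v = -g z u (A z v)) (w u v : E) :
    dg w (A y u) v + g y (dA w u) v = -(dg w u (A y v) + g y u (dA w v)) := by
  have hu := hasFDerivAt_const (𝕜 := ℝ) u y
  have hv := hasFDerivAt_const (𝕜 := ℝ) v y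
  have h1 := ((hg.clm_apply (hA.clm_apply hu)).clm_apply hv).congr_of_eventuallyEq
    (f₁ := fun z => -g z u (A z v)) (h.mono fun z hz => (hz u v).symm)
  have h2 := congrArg (fun f => f w)
    (h1.unique ((hg.clm_apply hu).clm_apply (hA.clm_apply hv)).neg)
  simp at h2
  linarith

theorem HyperhermitianMetric.inner_skew {𝓗 : HypercomplexStructure E M}
    (g : HyperhermitianMetric 𝓗) (L : ComplexStructure E M)
    (hL : ∀ (x : M) (v w : TangentSpace 𝓘(ℝ, E) x),
      g.inner x (L.toFun x v) (L.toFun x w) = g.inner x v w)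
    (x : M) (v w : TangentSpace 𝓘(ℝ, E) x) :
    g.inner x (L.toFun x v) w = -g.inner x v (L.toFun x w) := by
  have h := hL x (L.toFun x v) w
  rw [L.sq, map_neg, _root_.neg_apply] at h
  exact h.symm

theorem modelEndo_apply_modelEndo
    (A B : (x : M) → TangentSpace 𝓘(ℝ, E) x →L[ℝ] TangentSpace 𝓘(ℝ, E) x)
    (hx : x ∈ (chartAt E x₀).source) (v : E) :
    modelEndo A x₀ x (modelEndo B x₀ x v) = toModel x₀ x (A x (B x (ofModel x₀ x v))) := by
  simp only [modelEndo, ContinuousLinearMap.comp_apply, ofModel_toModel hx]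

theorem modelForm_apply
    (g : (x : M) → TangentSpace 𝓘(ℝ, E) x →L[ℝ] TangentSpace 𝓘(ℝ, E) x →L[ℝ] ℝ) (u v : E) :
    modelForm g x₀ x u v = g x (ofModel x₀ x u) (ofModel x₀ x v) :=
  rfl

theorem modelForm_skew {𝓗 : HypercomplexStructure E M}
    (g : HyperhermitianMetric 𝓗) (L : ComplexStructure E M)
    (hL : ∀ (x : M) (v w : TangentSpace 𝓘(ℝ, E) x),
      g.inner x (L.toFun x v) (L.toFun x w) = g.inner x v w)
    (hx : x ∈ (chartAt E x₀).source) (u v : E) :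
    modelForm g.inner x₀ x (modelEndo L.toFun x₀ x u) v =
      -modelForm g.inner x₀ x u (modelEndo L.toFun x₀ x v) := by
  simp only [modelForm_apply, modelEndo, ContinuousLinearMap.comp_apply, ofModel_toModel hx]
  exact g.inner_skew L hL x _ _

theorem modelEndo_self (L : (x : M) → TangentSpace 𝓘(ℝ, E) x →L[ℝ] TangentSpace 𝓘(ℝ, E) x)
    (x₀ : M) (v : E) : modelEndo L x₀ x₀ v = L x₀ v := by
  simp only [modelEndo, ContinuousLinearMap.comp_apply]
  rw [toModel_self, ofModel_self]

theorem modelEndo_II (L : ComplexStructure E M) (hx : x ∈ (chartAt E x₀).source) (v : E) :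
    modelEndo L.toFun x₀ x (modelEndo L.toFun x₀ x v) = -v := by
  rw [modelEndo_apply_modelEndo _ _ hx, L.sq, map_neg, toModel_ofModel hx]

theorem modelEndo_IJ (𝓗 : HypercomplexStructure E M) (hx : x ∈ (chartAt E x₀).source) (v : E) :
    modelEndo 𝓗.I.toFun x₀ x (modelEndo 𝓗.J.toFun x₀ x v) = modelEndo 𝓗.K.toFun x₀ x v := by
  rw [modelEndo_apply_modelEndo _ _ hx, modelEndo, ← 𝓗.IJ]
  rfl

theorem modelEndo_JI (𝓗 : HypercomplexStructure E M) (hx : x ∈ (chartAt E x₀).source) (v : E) :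
    modelEndo 𝓗.J.toFun x₀ x (modelEndo 𝓗.I.toFun x₀ x v) = -modelEndo 𝓗.K.toFun x₀ x v := by
  have h := congrArg (fun f => f (ofModel x₀ x v)) (𝓗.JI x)
  simp only [ContinuousLinearMap.comp_apply, _root_.neg_apply] at h
  rw [modelEndo_apply_modelEndo _ _ hx, h, map_neg]
  rfl

/-- The 1-jet at `x₀` of a hyperhermitian structure, read in the preferred chart at `x₀`. -/
def HyperhermitianMetric.jet [FiniteDimensional ℝ E] {𝓗 : HypercomplexStructure E M}
    (g : HyperhermitianMetric 𝓗) (x₀ : M) : HyperhermitianJet E :=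
  have hev := (eventually_extChartAt_symm_mem (E := E) x₀).mono fun _ h => h.2
  have hx := mem_chart_source E x₀
  have hself : (extChartAt 𝓘(ℝ, E) x₀).symm (extChartAt 𝓘(ℝ, E) x₀ x₀) = x₀ :=
    (extChartAt 𝓘(ℝ, E) x₀).left_inv (mem_extChartAt_source x₀)
  have hI := (𝓗.I.differentiableAt_modelEndo x₀).hasFDerivAt
  have hJ := (𝓗.J.differentiableAt_modelEndo x₀).hasFDerivAt
  have hK := (𝓗.K.differentiableAt_modelEndo x₀).hasFDerivAt
  have hg := (g.differentiableAt_modelForm x₀).hasFDerivAt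
  have hid := hasFDerivAt_const (𝕜 := ℝ) (-ContinuousLinearMap.id ℝ E)
    (extChartAt 𝓘(ℝ, E) x₀ x₀)
  { I := modelEndo 𝓗.I.toFun x₀ x₀
    J := modelEndo 𝓗.J.toFun x₀ x₀
    K := modelEndo 𝓗.K.toFun x₀ x₀
    dI := fderiv ℝ (fun y => modelEndo 𝓗.I.toFun x₀ ((extChartAt 𝓘(ℝ, E) x₀).symm y))
      (extChartAt 𝓘(ℝ, E) x₀ x₀)
    dJ := fderiv ℝ (fun y => modelEndo 𝓗.J.toFun x₀ ((extChartAt 𝓘(ℝ, E) x₀).symm y))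
      (extChartAt 𝓘(ℝ, E) x₀ x₀)
    dK := fderiv ℝ (fun y => modelEndo 𝓗.K.toFun x₀ ((extChartAt 𝓘(ℝ, E) x₀).symm y))
      (extChartAt 𝓘(ℝ, E) x₀ x₀)
    g := modelForm g.inner x₀ x₀
    dg := fderiv ℝ (fun y => modelForm g.inner x₀ ((extChartAt 𝓘(ℝ, E) x₀).symm y))
      (extChartAt 𝓘(ℝ, E) x₀ x₀)
    II := modelEndo_II 𝓗.I hx
    JJ := modelEndo_II 𝓗.J hx
    IJ := modelEndo_IJ 𝓗 hx
    JI := modelEndo_JI 𝓗 hx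
    dI_I := fun w v => by
      have h := hasFDerivAt_endo_comp hI hI hid (hev.mono fun z hz v => modelEndo_II 𝓗.I hz v) w v
      rwa [hself] at h
    dJ_J := fun w v => by
      have h := hasFDerivAt_endo_comp hJ hJ hid (hev.mono fun z hz v => modelEndo_II 𝓗.J hz v) w v
      rwa [hself] at h
    dI_J := fun w v => by
      have h := hasFDerivAt_endo_comp hI hJ hK (hev.mono fun z hz v => modelEndo_IJ 𝓗 hz v) w v
      rwa [hself] at h
    dJ_I := fun w v => by
      have h := hasFDerivAt_endo_comp hJ hI hK.neg
        (hev.mono fun z hz v => modelEndo_JI 𝓗 hz v) w v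
      rwa [hself] at h
    nijI := 𝓗.I.nijenhuis_modelEndo x₀ hI
    nijJ := 𝓗.J.nijenhuis_modelEndo x₀ hJ
    nijK := 𝓗.K.nijenhuis_modelEndo x₀ hK
    g_symm := fun u v => g.symm x₀ _ _
    gI := modelForm_skew g 𝓗.I g.hermI hx
    gJ := modelForm_skew g 𝓗.J g.hermJ hx
    gK := modelForm_skew g 𝓗.K g.hermK hx
    dg_symm := fun w u v => by
      have hu := hasFDerivAt_const (𝕜 := ℝ) u (extChartAt 𝓘(ℝ, E) x₀ x₀)
      have hv := hasFDerivAt_const (𝕜 := ℝ) v (extChartAt 𝓘(ℝ, E) x₀ x₀)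
      have h1 := (hg.clm_apply hu).clm_apply hv
      have h2 := (hg.clm_apply hv).clm_apply hu
      simp only [modelForm_apply, g.symm _ (ofModel x₀ _ v)] at h1 h2
      have h3 := congrArg (fun f => f w) (h1.unique h2)
      simpa using h3
    dgI := fun w u v => by
      have h := hasFDerivAt_skew hI hg (hev.mono fun z hz => modelForm_skew g 𝓗.I g.hermI hz) w u v
      rwa [hself] at h
    dgJ := fun w u v => by
      have h := hasFDerivAt_skew hJ hg (hev.mono fun z hz => modelForm_skew g 𝓗.J g.hermJ hz) w u v
      rwa [hself] at h
    dgK := fun w u v => by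
      have h := hasFDerivAt_skew hK hg (hev.mono fun z hz => modelForm_skew g 𝓗.K g.hermK hz) w u v
      rwa [hself] at h }

end Chart
end

noncomputable section

/-! ### The operator `d^c` on fundamental forms -/

section DC

set_option synthInstance.maxHeartbeats 400000

open Filter Topology

variable {E : Type*} [NormedAddCommGroup E] [NormedSpace ℝ E]

/-- The complex-valued alternating form `(u, v) ↦ (b(u, v) - b(v, u)) / 2`, as a continuous linear
function of the bilinear form `b`. -/
def complexAlternatization : (E →L[ℝ] E →L[ℝ] ℝ) →L[ℝ] E [⋀^Fin 2]→L[ℝ] ℂ :=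
  (1 / 2 : ℝ) • ContinuousAlternatingMap.alternatizeUncurryFinCLM ℝ E ℂ (n := 1) ∘L
    ContinuousLinearMap.compL ℝ E (E →L[ℝ] ℝ) (E [⋀^Fin 1]→L[ℝ] ℂ)
      ((ContinuousAlternatingMap.ofSubsingletonLIE (𝕜 := ℝ) (E := E) (F := ℂ)
        (0 : Fin 1)).toContinuousLinearEquiv.toContinuousLinearMap ∘L
        ContinuousLinearMap.compL ℝ E ℝ ℂ Complex.ofRealCLM)

theorem complexAlternatization_apply {b : E →L[ℝ] E →L[ℝ] ℝ} (hb : ∀ u v, b u v = -b v u)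
    (v : Fin 2 → E) : complexAlternatization b v = (b (v 0) (v 1) : ℝ) := by
  have h := hb (v 1) (v 0)
  simp [complexAlternatization, ContinuousAlternatingMap.alternatizeUncurryFin_apply,
    Fin.sum_univ_two, Fin.removeNth, h]
  ring

/-- The imaginary part of the `(2,1)`-component of a real 3-form. -/
theorem typeComponent_two_im {V : Type*} [AddCommGroup V] [Module ℝ V] [TopologicalSpace V]
    (J : V →L[ℝ] V) (η : V [⋀^Fin 3]→L[ℝ] ℂ) (r : V → V → V → ℝ)
    (hr : ∀ w, η w = (r (w 0) (w 1) (w 2) : ℝ)) (v : Fin 3 → V) :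
    (typeComponent J 2 η v).im = -(1 / 8) * (r (J (v 0)) (v 1) (v 2) + r (v 0) (J (v 1)) (v 2) +
      r (v 0) (v 1) (J (v 2)) + 3 * r (J (v 0)) (J (v 1)) (J (v 2))) := by
  have h1 (f : Finset (Fin 3) → ℂ) : ∑ S ∈ Finset.powersetCard 2 Finset.univ, f S =
      f {0, 1} + (f {0, 2} + f {1, 2}) := by
    rw [show Finset.powersetCard 2 (Finset.univ : Finset (Fin 3)) = {{0, 1}, {0, 2}, {1, 2}} by
      decide, Finset.sum_insert (by decide), Finset.sum_insert (by decide), Finset.sum_singleton]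
  have h2 (f : Finset (Fin 3) → ℂ) : ∑ T, f T = f ∅ + (f {0} + (f {1} + (f {2} + (f {0, 1} +
      (f {0, 2} + (f {1, 2} + f {0, 1, 2})))))) := by
    rw [show (Finset.univ : Finset (Finset (Fin 3))) =
      {∅, {0}, {1}, {2}, {0, 1}, {0, 2}, {1, 2}, {0, 1, 2}} by decide]
    repeat rw [Finset.sum_insert (by decide)]
    rw [Finset.sum_singleton]
  have h01 : (0 : Fin 3) ∉ ({1} : Finset (Fin 3)) := by decide
  have h02 : (0 : Fin 3) ∉ ({2} : Finset (Fin 3)) := by decide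
  have h12 : (1 : Fin 3) ∉ ({2} : Finset (Fin 3)) := by decide
  have h012 : (0 : Fin 3) ∉ ({1, 2} : Finset (Fin 3)) := by decide
  simp only [typeComponent, h1, h2, hr, Finset.prod_insert h01, Finset.prod_insert h02,
    Finset.prod_insert h12, Finset.prod_insert h012, Finset.prod_singleton, Finset.prod_empty,
    Finset.mem_insert, Finset.mem_singleton, Finset.notMem_empty]
  have h8 : ((1 : ℂ) / 2) ^ 3 = ((1 / 8 : ℝ) : ℂ) := by norm_num
  rw [h8]
  simp
  ring

theorem fderiv_complexAlternatization_apply {A : E → E →L[ℝ] E} {g : E → E →L[ℝ] E →L[ℝ] ℝ}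
    {dA : E →L[ℝ] E →L[ℝ] E} {dg : E →L[ℝ] E →L[ℝ] E →L[ℝ] ℝ} {y : E}
    (hA : HasFDerivAt A dA y) (hg : HasFDerivAt g dg y)
    (h : ∀ᶠ z in 𝓝 y, ∀ u v, g z (A z u) v = -g z (A z v) u) (w : Fin 2 → E) (u : E) :
    fderiv ℝ (fun z => complexAlternatization (g z ∘L A z) w) y u =
      ((dg u (A y (w 0)) (w 1) + g y (dA u (w 0)) (w 1) : ℝ) : ℂ) := by
  have hev : (fun z => complexAlternatization (g z ∘L A z) w) =ᶠ[𝓝 y]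
      fun z => ((g z (A z (w 0)) (w 1) : ℝ) : ℂ) := by
    filter_upwards [h] with z hz
    rw [complexAlternatization_apply fun u v => hz u v]
    rfl
  have h0 := hasFDerivAt_const (𝕜 := ℝ) (w 0) y
  have h1 := hasFDerivAt_const (𝕜 := ℝ) (w 1) y
  have h2 := (Complex.ofRealCLM.hasFDerivAt.comp y
    ((hg.clm_apply (hA.clm_apply h0)).clm_apply h1)).congr_of_eventuallyEq hev
  rw [h2.fderiv]
  simp [add_comm]

theorem extDeriv_complexAlternatization {A : E → E →L[ℝ] E} {g : E → E →L[ℝ] E →L[ℝ] ℝ}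
    {dA : E →L[ℝ] E →L[ℝ] E} {dg : E →L[ℝ] E →L[ℝ] E →L[ℝ] ℝ} {y : E}
    (hA : HasFDerivAt A dA y) (hg : HasFDerivAt g dg y)
    (h : ∀ᶠ z in 𝓝 y, ∀ u v, g z (A z u) v = -g z (A z v) u) (v : Fin 3 → E) :
    extDeriv (fun z => complexAlternatization (g z ∘L A z)) y v =
      (((dg (v 0) (A y (v 1)) (v 2) + g y (dA (v 0) (v 1)) (v 2)) -
        (dg (v 1) (A y (v 0)) (v 2) + g y (dA (v 1) (v 0)) (v 2)) +
        (dg (v 2) (A y (v 0)) (v 1) + g y (dA (v 2) (v 0)) (v 1)) : ℝ) : ℂ) := by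
  have hd : DifferentiableAt ℝ (fun z => complexAlternatization (g z ∘L A z)) y := by
    have h1 : DifferentiableAt ℝ (fun b => complexAlternatization (E := E) b) (g y ∘L A y) :=
      by fun_prop
    exact h1.comp y (hg.differentiableAt.clm_comp hA.differentiableAt)
  rw [extDeriv_apply hd]
  simp only [fderiv_complexAlternatization_apply hA hg h]
  simp [Fin.sum_univ_three, Fin.removeNth, Fin.succAbove]
  ring

variable [FiniteDimensional ℝ E] {M : Type*} [TopologicalSpace M] [ChartedSpace E M]
  [IsManifold 𝓘(ℝ, E) ∞ M] {𝓗 : HypercomplexStructure E M}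

theorem manifoldExtDeriv_fundamentalForm (g : HyperhermitianMetric 𝓗) (L : ComplexStructure E M)
    (hL : ∀ (x : M) (v w : TangentSpace 𝓘(ℝ, E) x),
      g.inner x (L.toFun x v) (L.toFun x w) = g.inner x v w)
    (x₀ : M) (v : Fin 3 → TangentSpace 𝓘(ℝ, E) x₀) :
    manifoldExtDeriv (fun y => Complex.ofRealCLM.compContinuousAlternatingMap
      (fundamentalForm g L hL y)) x₀ v =
      ((g.jet x₀).extDerivForm (modelEndo L.toFun x₀ x₀)
        (fderiv ℝ (fun y => modelEndo L.toFun x₀ ((extChartAt 𝓘(ℝ, E) x₀).symm y))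
          (extChartAt 𝓘(ℝ, E) x₀ x₀)) (v 0) (v 1) (v 2) : ℝ) := by
  have hself : (extChartAt 𝓘(ℝ, E) x₀).symm (extChartAt 𝓘(ℝ, E) x₀ x₀) = x₀ :=
    (extChartAt 𝓘(ℝ, E) x₀).left_inv (mem_extChartAt_source x₀)
  have hev : formInChart (fun y => Complex.ofRealCLM.compContinuousAlternatingMap
      (fundamentalForm g L hL y)) x₀ =ᶠ[𝓝 (extChartAt 𝓘(ℝ, E) x₀ x₀)]
        fun y => complexAlternatization
          (modelForm g.inner x₀ ((extChartAt 𝓘(ℝ, E) x₀).symm y) ∘L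
            modelEndo L.toFun x₀ ((extChartAt 𝓘(ℝ, E) x₀).symm y)) := by
    filter_upwards [eventually_extChartAt_symm_mem x₀] with y hy
    ext v
    rw [complexAlternatization_apply]
    · simp only [formInChart, mfderiv_extChartAt_symm hy.1]
      simp only [ContinuousLinearMap.comp_apply, modelForm_apply, modelEndo,
        ofModel_toModel hy.2]
      rfl
    · intro u v
      rw [ContinuousLinearMap.comp_apply, modelForm_skew g L hL hy.2, modelForm_apply, g.symm,
        ← modelForm_apply]
      rfl
  have h := extDeriv_complexAlternatization (L.differentiableAt_modelEndo x₀).hasFDerivAt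
    (g.differentiableAt_modelForm x₀).hasFDerivAt
    ((eventually_extChartAt_symm_mem x₀).mono fun z hz u v => by
      rw [modelForm_skew g L hL hz.2, modelForm_apply, g.symm, ← modelForm_apply]) v
  rw [← hev.extDeriv_eq, hself] at h
  rw [manifoldExtDeriv, mvfderiv_extChartAt (mem_chart_source E x₀)]
  refine Eq.trans ?_ h
  exact congrArg _ (funext fun i => toModel_self x₀ (v i))

/-- Since `dω_L` has type `(2,1) + (1,2)`, the form `d^c ω_L` is `-dω_L(L·, L·, L·) / 2`. -/
theorem dcOperator_fundamentalForm (g : HyperhermitianMetric 𝓗) (L : ComplexStructure E M)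
    (hL : ∀ (x : M) (v w : TangentSpace 𝓘(ℝ, E) x),
      g.inner x (L.toFun x v) (L.toFun x w) = g.inner x v w)
    (x₀ : M) (i : Fin 3) (hi : (g.jet x₀).str i = modelEndo L.toFun x₀ x₀)
    (hdi : (g.jet x₀).dstr i =
      fderiv ℝ (fun y => modelEndo L.toFun x₀ ((extChartAt 𝓘(ℝ, E) x₀).symm y))
        (extChartAt 𝓘(ℝ, E) x₀ x₀)) (v : Fin 3 → TangentSpace 𝓘(ℝ, E) x₀) :
    dcOperator L.toFun 1 1 (fundamentalForm g L hL) x₀ v =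
      -(1 / 2) * (g.jet x₀).extDerivForm ((g.jet x₀).str i) ((g.jet x₀).dstr i)
        ((g.jet x₀).str i (v 0)) ((g.jet x₀).str i (v 1)) ((g.jet x₀).str i (v 2)) := by
  set j := g.jet x₀
  have hJ : L.toFun x₀ = j.str i := by
    rw [hi]
    exact (ContinuousLinearMap.ext (modelEndo_self L.toFun x₀)).symm
  have h1 := typeComponent_two_im (V := E) (j.str i) _
    (j.extDerivForm (j.str i) (j.dstr i)) (fun w => by
      rw [hi, hdi]
      exact manifoldExtDeriv_fundamentalForm g L hL x₀ w) v
  have h2 := j.extDerivForm_type (j.str_str i) (j.dstr_eq_obata i) (j.g_str i) (j.dg_str i)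
    (v 0) (v 1) (v 2)
  rw [h2] at h1
  rw [dcOperator, delOperator, hJ]
  refine h1.trans ?_
  ring

theorem HyperhermitianMetric.isHKT_iff_jet (g : HyperhermitianMetric 𝓗) :
    g.IsHKT ↔ ∀ x, (g.jet x).IsHKT := by
  have hI (x : M) := dcOperator_fundamentalForm g 𝓗.I g.hermI x 0 rfl rfl
  have hJ (x : M) := dcOperator_fundamentalForm g 𝓗.J g.hermJ x 1 rfl rfl
  have hK (x : M) := dcOperator_fundamentalForm g 𝓗.K g.hermK x 2 rfl rfl
  constructor
  · rintro ⟨h1, h2⟩ x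
    have key (i : Fin 3) (u v w : E) :
        (g.jet x).extDerivForm ((g.jet x).str i) ((g.jet x).dstr i)
          ((g.jet x).str i u) ((g.jet x).str i v) ((g.jet x).str i w) =
        (g.jet x).extDerivForm ((g.jet x).str 0) ((g.jet x).dstr 0)
          ((g.jet x).str 0 u) ((g.jet x).str 0 v) ((g.jet x).str 0 w) := by
      have e1 := congrFun (congrFun h1 x) ![u, v, w]
      have e2 := congrFun (congrFun h2 x) ![u, v, w]
      rw [hI, hJ] at e1
      rw [hJ, hK] at e2
      fin_cases i
      · rfl
      · exact (mul_left_cancel₀ (by norm_num) e1).symm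
      · exact (mul_left_cancel₀ (by norm_num) (e1.trans e2)).symm
    intro i k u v w
    rw [key i, key k]
  · intro h
    constructor
    · funext x v
      exact (hI x v).trans ((congrArg _ (h x 0 1 _ _ _)).trans (hJ x v).symm)
    · funext x v
      exact (hJ x v).trans ((congrArg _ (h x 1 2 _ _ _)).trans (hK x v).symm)

end DC
end

noncomputable section

/-! ### The `(2,0)`-part of the bivector dual to `ω_I` -/

section PointwiseBivector

variable {V : Type*} [NormedAddCommGroup V] [NormedSpace ℝ V]

theorem isInvertible_of_injective [FiniteDimensional ℝ V] {σ : V →L[ℝ] V →L[ℝ] ℝ}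
    (hσ : Function.Injective σ) : σ.IsInvertible := by
  have h : Module.finrank ℝ V = Module.finrank ℝ (V →L[ℝ] ℝ) := by
    rw [← (LinearMap.toContinuousLinearMap (𝕜 := ℝ) (E := V) (F' := ℝ)).finrank_eq]
    exact (Subspace.dual_finrank_eq).symm
  let e := (LinearEquiv.ofInjectiveOfFinrankEq σ.toLinearMap hσ h).toContinuousLinearEquiv
  exact ⟨e, by ext; rfl⟩

theorem inverse_apply_eq [FiniteDimensional ℝ V] {σ : V →L[ℝ] V →L[ℝ] ℝ}
    (hσ : Function.Injective σ) {w : V} {γ : V →L[ℝ] ℝ} (h : σ w = γ) :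
    ContinuousLinearMap.inverse σ γ = w := by
  rw [← h]
  exact (isInvertible_of_injective hσ).inverse_apply_self w

/-- The complex coefficients of the `(2,0)`-part of `P_I` for `I_a` in terms of
`P_I`, `P_J`, `P_K`. -/
def twistorCoeff (a : UnitSphere2) : Fin 3 → ℂ :=
  ![(1 - (a.1 0 : ℂ) ^ 2) / 2, (-(a.1 0 * a.1 1) - Complex.I * a.1 2) / 2,
    (-(a.1 0 * a.1 2) + Complex.I * a.1 1) / 2]

theorem sphere_sq_add (a : UnitSphere2) :
    (a.1 0 : ℝ) ^ 2 + (a.1 1 : ℝ) ^ 2 + (a.1 2 : ℝ) ^ 2 = (1 : ℝ) := by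
  have h := a.2
  rw [mem_sphere_zero_iff_norm, EuclideanSpace.norm_eq, Real.sqrt_eq_one] at h
  simpa [Fin.sum_univ_three] using h

theorem twistorCoeff_isotropic (a : UnitSphere2) :
    twistorCoeff a 0 ^ 2 + twistorCoeff a 1 ^ 2 + twistorCoeff a 2 ^ 2 = 0 := by
  have h : (a.1 0 : ℂ) ^ 2 + (a.1 1 : ℂ) ^ 2 + (a.1 2 : ℂ) ^ 2 = 1 := by
    exact_mod_cast sphere_sq_add a
  simp only [twistorCoeff, Matrix.cons_val]
  have hI := Complex.I_sq
  generalize (a.1 0 : ℂ) = x at *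
  generalize (a.1 1 : ℂ) = y at *
  generalize (a.1 2 : ℂ) = z at *
  linear_combination (x ^ 2 - 1) / 4 * h + (y ^ 2 + z ^ 2) / 4 * hI

theorem dualBivector_component20 [FiniteDimensional ℝ V] {g : V →L[ℝ] V →L[ℝ] ℝ}
    {I J K : V →L[ℝ] V} (hI : ∀ v, I (I v) = -v) (hJ : ∀ v, J (J v) = -v)
    (hIJ : ∀ v, I (J v) = K v) (hJI : ∀ v, J (I v) = -K v) (hg : Function.Injective g)
    (hgI : ∀ v w, g (I v) w = -g v (I w)) (hgJ : ∀ v w, g (J v) w = -g v (J w))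
    (hgK : ∀ v w, g (K v) w = -g v (K w))
    (hσ : ∀ v, (g ∘L I) v v = 0) (a : UnitSphere2) {L : V →L[ℝ] V}
    (hL : L = (a.1 0) • I + (a.1 1) • J + (a.1 2) • K) {α β : V →L[ℝ] ℂ} {p q : V}
    (hp : g p = covectorRe α) (hq : g q = covectorIm α) :
    (dualBivector (g ∘L I) hσ).component20 L ![α, β] =
      -(twistorCoeff a 0 * (β (I p) + Complex.I * β (I q)) +
        twistorCoeff a 1 * (β (J p) + Complex.I * β (J q)) +
        twistorCoeff a 2 * (β (K p) + Complex.I * β (K q))) := by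
  have hIK (v : V) : I (K v) = -J v := by rw [← hIJ, hI]
  have hKJ (v : V) : K (J v) = -I v := by rw [← hIJ, hJ, map_neg]
  have hJK (v : V) : J (K v) = I v := by
    have h := hJI (J v)
    rw [hIJ, hKJ, neg_neg] at h
    exact h
  have hKI (v : V) : K (I v) = J v := by rw [← hIJ, hJI, map_neg, hIK, neg_neg]
  have hKK (v : V) : K (K v) = -v := by rw [← hIJ (K v), hJK, hI]
  have hgL (v w : V) : g (L v) w = -g v (L w) := by
    simp only [hL, _root_.add_apply, _root_.smul_apply, map_add, map_smul, hgI, hgJ, hgK,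
      smul_eq_mul]
    ring
  have hinj : Function.Injective (g ∘L I) := by
    refine hg.comp fun v w h => ?_
    have := congrArg I h
    simpa [hI] using this
  -- the vectors dual to the real and imaginary parts of the `(1,0)`-part of `α`
  have hre : formInv (g ∘L I) (covectorRe (covector10 L α)) = -(1 / 2 : ℝ) • I (p - L q) := by
    refine inverse_apply_eq hinj ?_
    ext w
    have h1 := congrArg (fun f => f w) hp
    have h2 := congrArg (fun f => f (L w)) hq
    simp [covectorRe, covectorIm, hI, hgL, covector10] at h1 h2 ⊢
    linarith
  have him : formInv (g ∘L I) (covectorIm (covector10 L α)) = -(1 / 2 : ℝ) • I (q + L p) := by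
    refine inverse_apply_eq hinj ?_
    ext w
    have h1 := congrArg (fun f => f (L w)) hp
    have h2 := congrArg (fun f => f w) hq
    simp [covectorRe, covectorIm, hI, hgL, covector10] at h1 h2 ⊢
    linarith
  have h0 : (dualBivector (g ∘L I) hσ).component20 L ![α, β] =
      covector10 L β (formInv (g ∘L I) (covectorRe (covector10 L α))) +
        Complex.I * covector10 L β (formInv (g ∘L I) (covectorIm (covector10 L α))) := rfl
  rw [h0, hre, him]
  have hs : (a.1 0 : ℂ) ^ 2 + (a.1 1 : ℂ) ^ 2 + (a.1 2 : ℂ) ^ 2 = 1 := by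
    exact_mod_cast sphere_sq_add a
  simp only [covector10, twistorCoeff, Matrix.cons_val, hL]
  simp [hI, hJ, hIJ, hJI, hIK, hKJ, hJK, hKI, hKK]
  have hi := Complex.I_sq
  generalize (a.1 0 : ℂ) = x at *
  generalize (a.1 1 : ℂ) = y at *
  generalize (a.1 2 : ℂ) = z at *
  linear_combination -(1 / 4 : ℂ) * (β (I p) + Complex.I * β (I q)) * hs +
    (-(1 / 4 : ℂ) * ((x ^ 2 - y ^ 2 - z ^ 2) * β (I p) + 2 * x * y * β (J p) +
      2 * x * z * β (K p)) - (1 / 4 : ℂ) * (x * β q + y * β (K q) - z * β (J q)) +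
      (1 / 2 : ℂ) * (y * β (K q) - z * β (J q))) * hi

end PointwiseBivector
end

noncomputable section

/-! ### Coefficients of the twistor bivector in a chart -/

section Coefficients

set_option synthInstance.maxHeartbeats 400000

variable {E : Type*} [NormedAddCommGroup E] [NormedSpace ℝ E]
  {M : Type*} [TopologicalSpace M] [ChartedSpace E M] [IsManifold 𝓘(ℝ, E) ∞ M]
  {𝓗 : HypercomplexStructure E M} {x₀ x : M}

/-- The complex structures `I`, `J`, `K`, indexed. -/
def HypercomplexStructure.str (𝓗 : HypercomplexStructure E M) : Fin 3 → ComplexStructure E M :=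
  ![𝓗.I, 𝓗.J, 𝓗.K]

/-- The isomorphism from covectors to vectors defined by the metric, read in the preferred chart
at `x₀`. -/
def HyperhermitianMetric.sharp (g : HyperhermitianMetric 𝓗) (x₀ x : M) : (E →L[ℝ] ℝ) →L[ℝ] E :=
  ContinuousLinearMap.inverse (modelForm g.inner x₀ x)

/-- The coefficients, in the preferred chart at `x₀`, of the bivector `P_L` dual to the fundamental
form of `L = I, J, K`. -/
def HyperhermitianMetric.dualCoeff (g : HyperhermitianMetric 𝓗) (i : Fin 3) (x₀ : M)
    (l m : E →L[ℝ] ℂ) (x : M) : ℂ :=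
  -(m (modelEndo (𝓗.str i).toFun x₀ x (g.sharp x₀ x (covectorRe l))) +
    Complex.I * m (modelEndo (𝓗.str i).toFun x₀ x (g.sharp x₀ x (covectorIm l))))

theorem HyperhermitianMetric.inner_injective (g : HyperhermitianMetric 𝓗) (x : M) :
    Function.Injective (g.inner x) := by
  refine (injective_iff_map_eq_zero (g.inner x)).2 fun v hv => ?_
  by_contra h
  have := g.pos x v h
  rw [hv] at this
  exact lt_irrefl _ this

theorem modelForm_injective (g : HyperhermitianMetric 𝓗) (hx : x ∈ (chartAt E x₀).source) :
    Function.Injective (modelForm g.inner x₀ x) := by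
  refine (injective_iff_map_eq_zero (modelForm g.inner x₀ x)).2 fun v hv => ?_
  have h : ofModel x₀ x v = 0 := by
    refine g.inner_injective x ?_
    ext w
    have := congrArg (fun f => f (toModel x₀ x w)) hv
    simpa [modelForm_apply, ofModel_toModel hx] using this
  rw [← toModel_ofModel hx v, h, map_zero]

theorem modelForm_sharp [FiniteDimensional ℝ E] (g : HyperhermitianMetric 𝓗)
    (hx : x ∈ (chartAt E x₀).source) (γ : E →L[ℝ] ℝ) :
    modelForm g.inner x₀ x (g.sharp x₀ x γ) = γ :=
  (isInvertible_of_injective (modelForm_injective g hx)).self_apply_inverse γ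

omit [IsManifold 𝓘(ℝ, E) ∞ M] in
theorem mfderiv_twistorSection (a : UnitSphere2) (x : M) (v : TangentSpace 𝓘(ℝ, E) x) :
    mfderiv 𝓘(ℝ, E) (𝓘(ℝ, E).prod (𝓡 2)) (twistorSection (M := M) a) x v = (v, 0) := by
  have h : twistorSection (M := M) a = fun x => (id x, (fun _ => a) x) := rfl
  rw [h, mfderiv_prodMk mdifferentiableAt_id mdifferentiableAt_const, mfderiv_id, mfderiv_const]
  rfl

/-- The coefficients of the twistor bivector only involve the restrictions of the two covectors to
the horizontal space `T_x M`. -/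
theorem HyperhermitianMetric.twistorBivector_apply [FiniteDimensional ℝ E]
    (g : HyperhermitianMetric 𝓗) (a : UnitSphere2) (hx : x ∈ (chartAt E x₀).source)
    (α β : TangentSpace (𝓘(ℝ, E).prod (𝓡 2)) (x, a) →L[ℝ] ℂ) (l m : E →L[ℝ] ℂ)
    (hα : ∀ v : E, α (ofModel x₀ x v, 0) = l v) (hβ : ∀ v : E, β (ofModel x₀ x v, 0) = m v) :
    g.twistorBivector (x, a) ![α, β] =
      ∑ i, twistorCoeff a i * g.dualCoeff i x₀ l m x := by
  let α' : TangentSpace 𝓘(ℝ, E) x →L[ℝ] ℂ := l ∘L toModel x₀ x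
  let β' : TangentSpace 𝓘(ℝ, E) x →L[ℝ] ℂ := m ∘L toModel x₀ x
  have hα' (v : TangentSpace 𝓘(ℝ, E) x) : α (v, 0) = α' v := by
    have := hα (toModel x₀ x v)
    rwa [ofModel_toModel hx] at this
  have hβ' (v : TangentSpace 𝓘(ℝ, E) x) : β (v, 0) = β' v := by
    have := hβ (toModel x₀ x v)
    rwa [ofModel_toModel hx] at this
  have h10 {γ : TangentSpace (𝓘(ℝ, E).prod (𝓡 2)) (x, a) →L[ℝ] ℂ} {γ' : TangentSpace 𝓘(ℝ, E) x →L[ℝ] ℂ}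
      (h : ∀ v : TangentSpace 𝓘(ℝ, E) x, γ (v, 0) = γ' v) (v : TangentSpace 𝓘(ℝ, E) x) :
      covector10 (𝓗.twistorStructure (x, a)) γ (v, 0) =
        covector10 (𝓗.structureAt a x) γ' v := by
    have h1 : 𝓗.twistorStructure (x, a) (v, 0) = (𝓗.structureAt a x v, 0) := by
      refine Prod.ext rfl ?_
      exact map_zero (sphereComplexStructure a)
    change (1 / 2 : ℂ) * (γ (v, 0) - Complex.I * γ (𝓗.twistorStructure (x, a) (v, 0))) =
      (1 / 2 : ℂ) * (γ' v - Complex.I * γ' (𝓗.structureAt a x v))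
    exact congrArg₂ (fun s t => (1 / 2 : ℂ) * (s - Complex.I * t)) (h v)
      ((congrArg γ h1).trans (h _))
  have h1 : g.twistorBivector (x, a) ![α, β] =
      (g.bivectorI x).component20 (𝓗.structureAt a x) ![α', β'] := by
    rw [Bivector.component20, AlternatingMap.compLinearMap_apply]
    change g.bivectorI x (fun i => (covector10 (𝓗.twistorStructure (x, a)) (![α, β] i)).comp
      (mfderiv 𝓘(ℝ, E) (𝓘(ℝ, E).prod (𝓡 2)) (twistorSection (M := M) a) x)) = _
    refine congrArg (g.bivectorI x) ?_
    funext i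
    refine ContinuousLinearMap.ext fun v => ?_
    fin_cases i
    · exact (congrArg _ (mfderiv_twistorSection a x v)).trans (h10 hα' v)
    · exact (congrArg _ (mfderiv_twistorSection a x v)).trans (h10 hβ' v)
  have hs (γ : E →L[ℝ] ℝ) : (g.inner x (ofModel x₀ x (g.sharp x₀ x γ)) : E →L[ℝ] ℝ) =
      γ ∘L toModel (E := E) x₀ x := by
    ext v
    have h := congrArg (fun f => f (toModel x₀ x v)) (modelForm_sharp g hx γ)
    simp only [modelForm_apply] at h
    rw [ofModel_toModel hx] at h
    exact h
  rw [h1]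
  refine (dualBivector_component20 (V := E) (g := g.inner x) (I := 𝓗.I.toFun x)
    (J := 𝓗.J.toFun x) (K := 𝓗.K.toFun x) (𝓗.I.sq x) (𝓗.J.sq x)
    (fun v => congrArg (fun f => f v) (𝓗.IJ x)) (fun v => congrArg (fun f => f v) (𝓗.JI x))
    (g.inner_injective x) (g.inner_skew 𝓗.I g.hermI x) (g.inner_skew 𝓗.J g.hermJ x)
    (g.inner_skew 𝓗.K g.hermK x) (fundamentalMap_self g 𝓗.I g.hermI x) a rfl
    (p := ofModel x₀ x (g.sharp x₀ x (covectorRe l)))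
    (q := ofModel x₀ x (g.sharp x₀ x (covectorIm l))) (α := α') (β := β') (hs _) (hs _)).trans ?_
  rw [Fin.sum_univ_three, ← mul_neg_one]
  change _ = twistorCoeff a 0 * -(m (modelEndo _ x₀ x _) + Complex.I * m (modelEndo _ x₀ x _)) +
    twistorCoeff a 1 * -(m (modelEndo _ x₀ x _) + Complex.I * m (modelEndo _ x₀ x _)) +
    twistorCoeff a 2 * -(m (modelEndo _ x₀ x _) + Complex.I * m (modelEndo _ x₀ x _))
  simp only [HypercomplexStructure.str, Matrix.cons_val]
  change (twistorCoeff a 0 * (m (modelEndo 𝓗.I.toFun x₀ x _) +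
      Complex.I * m (modelEndo 𝓗.I.toFun x₀ x _)) +
    twistorCoeff a 1 * (m (modelEndo 𝓗.J.toFun x₀ x _) +
      Complex.I * m (modelEndo 𝓗.J.toFun x₀ x _)) +
    twistorCoeff a 2 * (m (modelEndo 𝓗.K.toFun x₀ x _) +
      Complex.I * m (modelEndo 𝓗.K.toFun x₀ x _))) * -1 = _
  ring

/-! ### Type `(2,0)` -/

section Type20

variable {V : Type*} [AddCommGroup V] [Module ℝ V] [TopologicalSpace V]
  [IsTopologicalAddGroup V] [ContinuousSMul ℝ V]

theorem component20_component20 {J : V →L[ℝ] V} (hJ : ∀ v, J (J v) = -v) (B : Bivector V) :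
    (B.component20 J).component20 J = B.component20 J := by
  have h (α : V →L[ℝ] ℂ) : covector10 J (covector10 J α) = covector10 J α := by
    ext v
    simp [covector10, hJ]
    linear_combination (-(α v) / 2) * Complex.I_sq
  ext α
  refine congrArg B ?_
  funext i
  exact h (α i)

theorem euclideanCross_euclideanCross (a : UnitSphere2) {v : EuclideanSpace ℝ (Fin 3)}
    (hv : v ∈ (ℝ ∙ (a : EuclideanSpace ℝ (Fin 3)))ᗮ) :
    euclideanCross a (euclideanCross a v) = -v := by
  rw [Submodule.mem_orthogonal_singleton_iff_inner_right] at hv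
  have ha := sphere_sq_add a
  simp [PiLp.inner_apply, Fin.sum_univ_three] at hv
  ext i
  fin_cases i <;> simp [euclideanCross, crossProduct]
  · linear_combination a.1 0 * hv - v 0 * ha
  · linear_combination a.1 1 * hv - v 1 * ha
  · linear_combination a.1 2 * hv - v 2 * ha

theorem sphereComplexStructure_sq (a : UnitSphere2) (v : TangentSpace (𝓡 2) a) :
    sphereComplexStructure a (sphereComplexStructure a v) = -v := by
  refine (sphereTangentEquiv a).injective ?_
  have h (w : TangentSpace (𝓡 2) a) :
      sphereTangentEquiv a (sphereComplexStructure a w) =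
        (euclideanCross a).restrict (fun v _ => euclideanCross_mem a v)
          (sphereTangentEquiv a w) :=
    (sphereTangentEquiv a).apply_symm_apply _
  rw [h, h, map_neg]
  exact Subtype.ext (euclideanCross_euclideanCross a (sphereTangentEquiv a v).2)

theorem HypercomplexStructure.structureAt_sq (𝓗 : HypercomplexStructure E M) (a : UnitSphere2)
    (x : M) (v : TangentSpace 𝓘(ℝ, E) x) :
    𝓗.structureAt a x (𝓗.structureAt a x v) = -v := by
  have hI := 𝓗.I.sq x
  have hJ := 𝓗.J.sq x
  have hK := 𝓗.K.sq x
  have hIJ (v) : 𝓗.I.toFun x (𝓗.J.toFun x v) = 𝓗.K.toFun x v :=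
    congrArg (fun f => f v) (𝓗.IJ x)
  have hJI (v) : 𝓗.J.toFun x (𝓗.I.toFun x v) = -𝓗.K.toFun x v :=
    congrArg (fun f => f v) (𝓗.JI x)
  have hIK (v) : 𝓗.I.toFun x (𝓗.K.toFun x v) = -𝓗.J.toFun x v := by rw [← hIJ, hI]
  have hKJ (v) : 𝓗.K.toFun x (𝓗.J.toFun x v) = -𝓗.I.toFun x v := by rw [← hIJ, hJ, map_neg]
  have hJK (v) : 𝓗.J.toFun x (𝓗.K.toFun x v) = 𝓗.I.toFun x v := by
    have h := hJI (𝓗.J.toFun x v)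
    rw [hIJ, hKJ, neg_neg] at h
    exact h
  have hKI (v) : 𝓗.K.toFun x (𝓗.I.toFun x v) = 𝓗.J.toFun x v := by
    rw [← hIJ, hJI, map_neg, hIK, neg_neg]
  have ha := sphere_sq_add a
  simp only [HypercomplexStructure.structureAt, _root_.add_apply, _root_.smul_apply, map_add,
    map_smul, hI, hJ, hK, hIJ, hJI, hIK, hKJ, hJK, hKI]
  linear_combination (norm := module) (-ha) • v

theorem HypercomplexStructure.twistorStructure_sq (𝓗 : HypercomplexStructure E M)
    (z : M × UnitSphere2) (v : TangentSpace (𝓘(ℝ, E).prod (𝓡 2)) z) :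
    𝓗.twistorStructure z (𝓗.twistorStructure z v) = -v :=
  Prod.ext (𝓗.structureAt_sq z.2 z.1 v.1) (sphereComplexStructure_sq z.2 v.2)

end Type20

end Coefficients
end

noncomputable section

/-! ### Smoothness of the twistor bivector -/

section Smoothness

set_option synthInstance.maxHeartbeats 400000

open Filter Topology

variable {E : Type*} [NormedAddCommGroup E] [NormedSpace ℝ E]
  {M : Type*} [TopologicalSpace M] [ChartedSpace E M] [IsManifold 𝓘(ℝ, E) ∞ M]
  {𝓗 : HypercomplexStructure E M} {x₀ x : M}

omit [IsManifold 𝓘(ℝ, E) ∞ M] in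
/-- The differential of a function on `M × S²` on horizontal vectors. -/
theorem mvfderiv_prodMk_zero {W : Type*} [NormedAddCommGroup W] [NormedSpace ℝ W]
    {F : M × UnitSphere2 → W} {z : M × UnitSphere2}
    (hF : MDifferentiableAt (𝓘(ℝ, E).prod (𝓡 2)) 𝓘(ℝ, W) F z) (v : TangentSpace 𝓘(ℝ, E) z.1) :
    mvfderiv (𝓘(ℝ, E).prod (𝓡 2)) F z (v, 0) =
      mvfderiv 𝓘(ℝ, E) (fun x => F (x, z.2)) z.1 v := by
  have hs : MDifferentiableAt 𝓘(ℝ, E) (𝓘(ℝ, E).prod (𝓡 2)) (twistorSection (M := M) z.2) z.1 :=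
    mdifferentiableAt_id.prodMk mdifferentiableAt_const
  have h := mfderiv_comp_apply (f := twistorSection (M := M) z.2) z.1 hF hs v
  refine Eq.trans ?_ h.symm
  exact congrArg (mfderiv (𝓘(ℝ, E).prod (𝓡 2)) 𝓘(ℝ, W) F z)
    (mfderiv_twistorSection z.2 z.1 v).symm

omit [NormedSpace ℝ E] [IsManifold 𝓘(ℝ, E) ∞ M] in
theorem mem_chartAt_prod_source {z w : M × UnitSphere2}
    (hw : w ∈ (chartAt (ModelProd E (EuclideanSpace ℝ (Fin 2))) z).source) :
    w.1 ∈ (chartAt E z.1).source := by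
  rw [prodChartedSpace_chartAt] at hw
  exact hw.1

theorem coordCovector_prodMk_zero {z w : M × UnitSphere2}
    (hw : w ∈ (chartAt (ModelProd E (EuclideanSpace ℝ (Fin 2))) z).source)
    (l : E × EuclideanSpace ℝ (Fin 2) →L[ℝ] ℂ) (v : E) :
    coordCovector (𝓘(ℝ, E).prod (𝓡 2)) z l w (ofModel z.1 w.1 v, 0) =
      (l ∘L ContinuousLinearMap.inl ℝ E _) v := by
  have hw1 := mem_chartAt_prod_source hw
  have hd : MDifferentiableAt (𝓘(ℝ, E).prod (𝓡 2)) 𝓘(ℝ, E × EuclideanSpace ℝ (Fin 2))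
      (extChartAt (𝓘(ℝ, E).prod (𝓡 2)) z) w := mdifferentiableAt_extChartAt hw
  have hd1 : MDifferentiableAt 𝓘(ℝ, E) 𝓘(ℝ, E) (extChartAt 𝓘(ℝ, E) z.1) w.1 :=
    mdifferentiableAt_extChartAt hw1
  have h1 := mvfderiv_prodMk_zero hd (ofModel z.1 w.1 v)
  let G : E → E × EuclideanSpace ℝ (Fin 2) := fun y => (y, extChartAt (𝓡 2) z.2 w.2)
  have hG : HasFDerivAt G (ContinuousLinearMap.inl ℝ E _) (extChartAt 𝓘(ℝ, E) z.1 w.1) :=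
    (hasFDerivAt_id _).prodMk (hasFDerivAt_const _ _)
  have h2 : (fun x => extChartAt (𝓘(ℝ, E).prod (𝓡 2)) z (x, w.2)) =
      G ∘ extChartAt 𝓘(ℝ, E) z.1 := by
    funext x
    rw [extChartAt_prod]
    rfl
  have h3 : mvfderiv 𝓘(ℝ, E) (fun x => extChartAt (𝓘(ℝ, E).prod (𝓡 2)) z (x, w.2)) w.1
      (ofModel z.1 w.1 v) = (v, 0) := by
    rw [h2]
    refine (mfderiv_comp_apply (I' := 𝓘(ℝ, E)) w.1 hG.differentiableAt.mdifferentiableAt hd1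
      (ofModel z.1 w.1 v)).trans ?_
    rw [mfderiv_eq_fderiv, hG.fderiv]
    have h4 : mfderiv 𝓘(ℝ, E) 𝓘(ℝ, E) (extChartAt 𝓘(ℝ, E) z.1) w.1 (ofModel z.1 w.1 v) = v :=
      (congrArg (fun f => f (ofModel z.1 w.1 v)) (mvfderiv_extChartAt hw1)).trans
        (toModel_ofModel hw1 v)
    exact congrArg (ContinuousLinearMap.inl ℝ E (EuclideanSpace ℝ (Fin 2))) h4
  exact congrArg l (h1.trans h3)

variable [FiniteDimensional ℝ E] (g : HyperhermitianMetric 𝓗)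

theorem HyperhermitianMetric.bivectorCoeff_twistorBivector {z w : M × UnitSphere2}
    (hw : w ∈ (chartAt (ModelProd E (EuclideanSpace ℝ (Fin 2))) z).source)
    (l m : E × EuclideanSpace ℝ (Fin 2) →L[ℝ] ℂ) :
    bivectorCoeff (𝓘(ℝ, E).prod (𝓡 2)) g.twistorBivector z l m w =
      ∑ i, twistorCoeff w.2 i * g.dualCoeff i z.1 (l ∘L ContinuousLinearMap.inl ℝ E _)
        (m ∘L ContinuousLinearMap.inl ℝ E _) w.1 :=
  g.twistorBivector_apply w.2 (mem_chartAt_prod_source hw) _ _ _ _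
    (coordCovector_prodMk_zero hw l) (coordCovector_prodMk_zero hw m)

theorem HyperhermitianMetric.contMDiffOn_sharp (x₀ : M) :
    ContMDiffOn 𝓘(ℝ, E) 𝓘(ℝ, (E →L[ℝ] ℝ) →L[ℝ] E) ∞ (g.sharp x₀) (chartAt E x₀).source := by
  intro x hx
  have h := (g.contMDiffOn_modelForm' x₀).contMDiffAt ((chartAt E x₀).open_source.mem_nhds hx)
  obtain ⟨e, he⟩ := isInvertible_of_injective (modelForm_injective g hx)
  have h2 : ContDiffAt ℝ ∞ ContinuousLinearMap.inverse (modelForm g.inner x₀ x) := by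
    rw [← he]
    exact contDiffAt_map_inverse e
  exact (h2.comp_contMDiffAt h).contMDiffWithinAt

theorem HyperhermitianMetric.contMDiffOn_modelEndo_sharp (L : ComplexStructure E M) (x₀ : M)
    (γ : E →L[ℝ] ℝ) : ContMDiffOn 𝓘(ℝ, E) 𝓘(ℝ, E) ∞
      (fun x => modelEndo L.toFun x₀ x (g.sharp x₀ x γ)) (chartAt E x₀).source :=
  (L.contMDiffOn_modelEndo x₀).clm_apply ((g.contMDiffOn_sharp x₀).clm_apply contMDiffOn_const)

theorem HyperhermitianMetric.contMDiffOn_dualCoeff (i : Fin 3) (x₀ : M) (l m : E →L[ℝ] ℂ) :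
    ContMDiffOn 𝓘(ℝ, E) 𝓘(ℝ, ℂ) ∞ (g.dualCoeff i x₀ l m) (chartAt E x₀).source := by
  have hf : ContDiff ℝ ∞ (fun p : E × E => -(m p.1 + Complex.I * m p.2)) := by fun_prop
  intro x hx
  exact hf.contDiffAt.comp_contMDiffWithinAt
    ((g.contMDiffOn_modelEndo_sharp (𝓗.str i) x₀ (covectorRe l) x hx).prodMk_space
      (g.contMDiffOn_modelEndo_sharp (𝓗.str i) x₀ (covectorIm l) x hx))

theorem contMDiff_twistorCoeff (i : Fin 3) :
    ContMDiff (𝓡 2) 𝓘(ℝ, ℂ) ∞ (fun a => twistorCoeff a i) := by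
  have := Fact.mk (@finrank_euclideanSpace_fin ℝ _ (2 + 1))
  have hc : ContMDiff (𝓡 2) 𝓘(ℝ, EuclideanSpace ℝ (Fin 3)) ∞
      (fun a : UnitSphere2 => (a : EuclideanSpace ℝ (Fin 3))) := contMDiff_coe_sphere
  have h (k : Fin 3) : ContDiff ℝ ∞ (fun e : EuclideanSpace ℝ (Fin 3) => (e k : ℂ)) :=
    Complex.ofRealCLM.contDiff.comp (EuclideanSpace.proj (𝕜 := ℝ) k).contDiff
  have hf : ContDiff ℝ ∞ (fun e : EuclideanSpace ℝ (Fin 3) =>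
      (![(1 - (e 0 : ℂ) ^ 2) / 2, (-(e 0 * e 1) - Complex.I * e 2) / 2,
        (-(e 0 * e 2) + Complex.I * e 1) / 2] : Fin 3 → ℂ) i) := by
    fin_cases i
    · exact (contDiff_const.sub ((h 0).pow 2)).div_const 2
    · exact (((h 0).mul (h 1)).neg.sub (contDiff_const.mul (h 2))).div_const 2
    · exact (((h 0).mul (h 2)).neg.add (contDiff_const.mul (h 1))).div_const 2
  exact hf.contMDiff.comp hc

theorem HyperhermitianMetric.smoothBivector_twistorBivector :
    SmoothBivector (𝓘(ℝ, E).prod (𝓡 2)) g.twistorBivector := by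
  intro z l m
  have hmul : ContDiff ℝ ∞ (fun p : ((ℂ × ℂ) × (ℂ × ℂ)) × (ℂ × ℂ) =>
    p.1.1.1 * p.1.1.2 + p.1.2.1 * p.1.2.2 + p.2.1 * p.2.2) := by fun_prop
  have h (i : Fin 3) : ContMDiffOn (𝓘(ℝ, E).prod (𝓡 2)) 𝓘(ℝ, ℂ × ℂ) ∞
      (fun w => (twistorCoeff w.2 i, g.dualCoeff i z.1 (l ∘L ContinuousLinearMap.inl ℝ E _)
        (m ∘L ContinuousLinearMap.inl ℝ E _) w.1))
      (chartAt (ModelProd E (EuclideanSpace ℝ (Fin 2))) z).source :=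
    ((contMDiff_twistorCoeff i).comp contMDiff_snd).contMDiffOn.prodMk_space
      ((g.contMDiffOn_dualCoeff i z.1 _ _).comp contMDiff_fst.contMDiffOn
        (fun w hw => mem_chartAt_prod_source hw))
  intro w hw
  have h0 := hmul.contDiffAt.comp_contMDiffWithinAt
    (((h 0 w hw).prodMk_space (h 1 w hw)).prodMk_space (h 2 w hw))
  have heq (w : M × UnitSphere2)
      (hw : w ∈ (chartAt (ModelProd E (EuclideanSpace ℝ (Fin 2))) z).source) :=
    (g.bivectorCoeff_twistorBivector hw l m).trans (Fin.sum_univ_three _)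
  exact h0.congr heq (heq w hw)

end Smoothness
end

noncomputable section

/-! ### The Schouten bracket of the twistor bivector -/

section Schouten

set_option synthInstance.maxHeartbeats 400000

open Filter Topology

variable {E : Type*} [NormedAddCommGroup E] [NormedSpace ℝ E]

/-- The derivative of `A g⁻¹ γ`, for a field of endomorphisms `A`, a field of symmetric forms `g`
and a constant covector `γ`; here `S` is the inverse of `g`. -/
theorem fderiv_endo_sharp {A : E → E →L[ℝ] E} {g : E → E →L[ℝ] E →L[ℝ] ℝ}
    {S : E → (E →L[ℝ] ℝ) →L[ℝ] E} {y : E} (hA : DifferentiableAt ℝ A y)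
    (hg : DifferentiableAt ℝ g y) (hS : DifferentiableAt ℝ S y)
    (h : ∀ᶠ z in 𝓝 y, ∀ γ, g z (S z γ) = γ) (hsymm : ∀ u v, g y u v = g y v u)
    (hskew : ∀ u v, g y (A y u) v = -g y u (A y v)) (γ : E →L[ℝ] ℝ) (u w : E) :
    g y w (fderiv ℝ (fun z => A z (S z γ)) y u) =
      fderiv ℝ g y u (S y γ) (A y w) + g y (fderiv ℝ A y u (S y γ)) w := by
  have hγ := hasFDerivAt_const (𝕜 := ℝ) γ y
  have h1 := hS.hasFDerivAt.clm_apply hγ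
  have h2 := congrArg (fun f => f u (A y w))
    ((hg.hasFDerivAt.clm_apply h1).congr_of_eventuallyEq
      (h.mono fun z hz => (hz γ).symm) |>.unique hγ)
  rw [(hA.hasFDerivAt.clm_apply h1).fderiv]
  simp at h2 ⊢
  rw [hsymm w, hsymm w, hskew]
  linarith

variable {M : Type*} [TopologicalSpace M] [ChartedSpace E M] [IsManifold 𝓘(ℝ, E) ∞ M]
  {𝓗 : HypercomplexStructure E M} [FiniteDimensional ℝ E] (g : HyperhermitianMetric 𝓗) (x₀ : M)

/-- The derivative in a chart of the vector `L g⁻¹ γ`, where `L = I, J, K` and `γ` is a constant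
covector. -/
def HyperhermitianMetric.fderivSharp (i : Fin 3) (γ : E →L[ℝ] ℝ) : E →L[ℝ] E :=
  fderiv ℝ (fun y => modelEndo (𝓗.str i).toFun x₀ ((extChartAt 𝓘(ℝ, E) x₀).symm y)
    (g.sharp x₀ ((extChartAt 𝓘(ℝ, E) x₀).symm y) γ)) (extChartAt 𝓘(ℝ, E) x₀ x₀)

theorem HyperhermitianMetric.jet_str (i : Fin 3) :
    (g.jet x₀).str i = modelEndo (𝓗.str i).toFun x₀ x₀ := by
  fin_cases i <;> rfl

theorem HyperhermitianMetric.jet_dstr (i : Fin 3) :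
    (g.jet x₀).dstr i = fderiv ℝ (fun y => modelEndo (𝓗.str i).toFun x₀
      ((extChartAt 𝓘(ℝ, E) x₀).symm y)) (extChartAt 𝓘(ℝ, E) x₀ x₀) := by
  fin_cases i <;> rfl

theorem HyperhermitianMetric.g_fderivSharp (i : Fin 3) (γ : E →L[ℝ] ℝ) (u w : E) :
    (g.jet x₀).g w (g.fderivSharp x₀ i γ u) =
      (g.jet x₀).dg u (g.sharp x₀ x₀ γ) ((g.jet x₀).str i w) +
        (g.jet x₀).g ((g.jet x₀).dstr i u (g.sharp x₀ x₀ γ)) w := by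
  have hself : (extChartAt 𝓘(ℝ, E) x₀).symm (extChartAt 𝓘(ℝ, E) x₀ x₀) = x₀ :=
    (extChartAt 𝓘(ℝ, E) x₀).left_inv (mem_extChartAt_source x₀)
  have hS : DifferentiableAt ℝ (fun y => g.sharp x₀ ((extChartAt 𝓘(ℝ, E) x₀).symm y))
      (extChartAt 𝓘(ℝ, E) x₀ x₀) :=
    (contDiffAt_comp_extChartAt_symm (g.contMDiffOn_sharp x₀)
      (mem_extChartAt_target x₀)).differentiableAt (by simp)
  have hst (u v : E) := (g.jet x₀).g_str i u v
  rw [g.jet_str] at hst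
  have h := fderiv_endo_sharp ((𝓗.str i).differentiableAt_modelEndo x₀)
    (g.differentiableAt_modelForm x₀) hS
    ((eventually_extChartAt_symm_mem (E := E) x₀).mono fun y hy => modelForm_sharp g hy.2)
    (by rw [hself]; exact (g.jet x₀).g_symm) (by rw [hself]; exact hst) γ u w
  rw [hself] at h
  rw [g.jet_str, g.jet_dstr]
  exact h

/-- The vectors dual to the real and imaginary parts of a complex covector. -/
def HyperhermitianMetric.sharpParts (l : E →L[ℝ] ℂ) : Fin 2 → E :=
  ![g.sharp x₀ x₀ (covectorRe l), g.sharp x₀ x₀ (covectorIm l)]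

/-- The summand of `schoutenSq` without the cyclic sum. -/
def HyperhermitianJet.dualDerivSum (j : HyperhermitianJet E) (c : Fin 3 → ℂ) (u v w : E) : ℂ :=
  ∑ i, ∑ k, c i * c k * (j.dualDeriv (j.str i) (j.str k) (j.dstr k) u v w : ℝ)

omit [FiniteDimensional ℝ E] in
theorem HyperhermitianJet.schoutenSq_eq_dualDerivSum (j : HyperhermitianJet E) (c : Fin 3 → ℂ)
    (u v w : E) : j.schoutenSq c u v w =
      j.dualDerivSum c u v w + j.dualDerivSum c v w u + j.dualDerivSum c w u v := by
  simp only [schoutenSq, dualDerivSum, cyclicDualDeriv, ← Finset.sum_add_distrib]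
  refine Finset.sum_congr rfl fun i _ => Finset.sum_congr rfl fun k _ => ?_
  push_cast
  ring

/-- The value on complex vectors `u₀ + i u₁`, `v₀ + i v₁`, `w₀ + i w₁` of the complex-trilinear
extension of `f`. -/
def complexTrilinear (f : E → E → E → ℂ) (u v w : Fin 2 → E) : ℂ :=
  ∑ r : Fin 2, ∑ s : Fin 2, ∑ t : Fin 2, Complex.I ^ (r.val + s.val + t.val) * f (u r) (v s) (w t)

theorem HyperhermitianMetric.apply_eq_sharpParts (n : E →L[ℝ] ℂ) (e : E) :
    n e = ((g.jet x₀).g (g.sharpParts x₀ n 0) e : ℂ) +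
      Complex.I * ((g.jet x₀).g (g.sharpParts x₀ n 1) e : ℂ) := by
  have h (γ : E →L[ℝ] ℝ) : (g.jet x₀).g (g.sharp x₀ x₀ γ) = γ :=
    modelForm_sharp g (mem_chart_source E x₀) γ
  simp only [sharpParts, Matrix.cons_val_zero, Matrix.cons_val_one, h]
  rw [mul_comm]
  exact (Complex.re_add_im _).symm

theorem HyperhermitianMetric.hasFDerivAt_dualCoeff (i : Fin 3) (m n : E →L[ℝ] ℂ) :
    HasFDerivAt (fun y => g.dualCoeff i x₀ m n ((extChartAt 𝓘(ℝ, E) x₀).symm y))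
      (-(n ∘L g.fderivSharp x₀ i (covectorRe m) +
        Complex.I • (n ∘L g.fderivSharp x₀ i (covectorIm m)))) (extChartAt 𝓘(ℝ, E) x₀ x₀) := by
  have h (γ : E →L[ℝ] ℝ) := n.hasFDerivAt.comp (extChartAt 𝓘(ℝ, E) x₀ x₀)
    ((contDiffAt_comp_extChartAt_symm (g.contMDiffOn_modelEndo_sharp (𝓗.str i) x₀ γ)
      (mem_extChartAt_target x₀)).differentiableAt (by simp)).hasFDerivAt
  exact ((h (covectorRe m)).add ((h (covectorIm m)).const_mul Complex.I)).neg

/-- The differential at `x₀` of the coefficient of the bivector `∑ c_L P_L`. -/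
def HyperhermitianMetric.fderivCoeff (c : Fin 3 → ℂ) (m n : E →L[ℝ] ℂ) : E →L[ℝ] ℂ :=
  fderiv ℝ (fun y => ∑ i, c i * g.dualCoeff i x₀ m n ((extChartAt 𝓘(ℝ, E) x₀).symm y))
    (extChartAt 𝓘(ℝ, E) x₀ x₀)

theorem HyperhermitianMetric.fderivCoeff_apply (c : Fin 3 → ℂ) (m n : E →L[ℝ] ℂ) (u : E) :
    g.fderivCoeff x₀ c m n u = -∑ i, c i * ∑ s : Fin 2, ∑ t : Fin 2,
      Complex.I ^ (s.val + t.val) *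
      ((g.jet x₀).dg u (g.sharpParts x₀ m s) ((g.jet x₀).str i (g.sharpParts x₀ n t)) +
        (g.jet x₀).g ((g.jet x₀).dstr i u (g.sharpParts x₀ m s)) (g.sharpParts x₀ n t) : ℝ) := by
  have h := HasFDerivAt.fun_sum (u := Finset.univ) fun i _ =>
    (g.hasFDerivAt_dualCoeff x₀ i m n).const_mul (c i)
  rw [fderivCoeff, h.fderiv, _root_.sum_apply, ← Finset.sum_neg_distrib]
  refine Finset.sum_congr rfl fun i _ => ?_
  change c i * -(n (g.fderivSharp x₀ i _ u) + Complex.I * n (g.fderivSharp x₀ i _ u)) = _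
  rw [g.apply_eq_sharpParts x₀ n, g.apply_eq_sharpParts x₀ n (g.fderivSharp x₀ i _ u)]
  simp only [g_fderivSharp, Fin.sum_univ_two]
  push_cast
  simp only [Fin.val_zero, Fin.val_one, sharpParts, Matrix.cons_val_zero, Matrix.cons_val_one]
  ring

theorem HyperhermitianMetric.schoutenTerm_eq_fderivCoeff (a : UnitSphere2)
    (l m n : E × EuclideanSpace ℝ (Fin 2) →L[ℝ] ℂ) :
    schoutenTerm (𝓘(ℝ, E).prod (𝓡 2)) g.twistorBivector g.twistorBivector (x₀, a) l m n =
      ∑ i, twistorCoeff a i * g.dualCoeff i x₀ (l ∘L ContinuousLinearMap.inl ℝ E _)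
        (g.fderivCoeff x₀ (twistorCoeff a) (m ∘L ContinuousLinearMap.inl ℝ E _)
          (n ∘L ContinuousLinearMap.inl ℝ E _)) x₀ := by
  have hz := mem_chart_source (ModelProd E (EuclideanSpace ℝ (Fin 2))) (x₀, a)
  refine g.twistorBivector_apply a (mem_chart_source E x₀) _ _ _ _
    (coordCovector_prodMk_zero hz l) fun v => ?_
  set F := bivectorCoeff (𝓘(ℝ, E).prod (𝓡 2)) g.twistorBivector (x₀, a) m n with hFdef
  have hF : MDifferentiableAt (𝓘(ℝ, E).prod (𝓡 2)) 𝓘(ℝ, ℂ) F (x₀, a) :=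
    ((g.smoothBivector_twistorBivector (x₀, a) m n).contMDiffAt
      ((chartAt _ _).open_source.mem_nhds hz)).mdifferentiableAt (by simp)
  have hs : MDifferentiableAt 𝓘(ℝ, E) (𝓘(ℝ, E).prod (𝓡 2)) (twistorSection (M := M) a) x₀ :=
    mdifferentiableAt_id.prodMk mdifferentiableAt_const
  have hFs : MDifferentiableAt 𝓘(ℝ, E) 𝓘(ℝ, ℂ) (fun x => F (x, a)) x₀ :=
    MDifferentiableAt.comp (f := twistorSection (M := M) a) x₀ hF hs
  refine (mvfderiv_prodMk_zero hF (ofModel x₀ x₀ v)).trans ?_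
  have h1 : mfderiv 𝓘(ℝ, E) 𝓘(ℝ, ℂ) (fun x => F (x, a)) x₀ =
      g.fderivCoeff x₀ (twistorCoeff a) (m ∘L ContinuousLinearMap.inl ℝ E _)
        (n ∘L ContinuousLinearMap.inl ℝ E _) := by
    rw [hFs.mfderiv, ModelWithCorners.range_eq_univ, fderivWithin_univ, fderivCoeff]
    refine Filter.EventuallyEq.fderiv_eq ?_
    filter_upwards [eventually_extChartAt_symm_mem x₀] with y hy
    refine g.bivectorCoeff_twistorBivector (z := (x₀, a)) ?_ m n
    rw [prodChartedSpace_chartAt]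
    exact ⟨hy.2, mem_chart_source _ a⟩
  refine (congrArg (fun f => f (ofModel x₀ x₀ v)) h1).trans ?_
  exact congrArg _ (ofModel_self x₀ v)

theorem HyperhermitianMetric.schoutenTerm_twistorBivector (a : UnitSphere2)
    (l m n : E × EuclideanSpace ℝ (Fin 2) →L[ℝ] ℂ) :
    schoutenTerm (𝓘(ℝ, E).prod (𝓡 2)) g.twistorBivector g.twistorBivector (x₀, a) l m n =
      complexTrilinear ((g.jet x₀).dualDerivSum (twistorCoeff a))
        (g.sharpParts x₀ (l ∘L ContinuousLinearMap.inl ℝ E _))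
        (g.sharpParts x₀ (m ∘L ContinuousLinearMap.inl ℝ E _))
        (g.sharpParts x₀ (n ∘L ContinuousLinearMap.inl ℝ E _)) := by
  rw [schoutenTerm_eq_fderivCoeff]
  have h (k : Fin 3) (l m : E →L[ℝ] ℂ) : g.dualCoeff k x₀ l m x₀ =
      -∑ r : Fin 2, Complex.I ^ r.val * m ((g.jet x₀).str k (g.sharpParts x₀ l r)) := by
    rw [g.jet_str, Fin.sum_univ_two]
    simp [dualCoeff, sharpParts]
  simp only [h, fderivCoeff_apply, complexTrilinear, HyperhermitianJet.dualDerivSum,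
    HyperhermitianJet.dualDeriv]
  simp only [Fin.sum_univ_two, Fin.sum_univ_three]
  ring

theorem HyperhermitianMetric.schoutenBracket_twistorBivector (a : UnitSphere2)
    (l m n : E × EuclideanSpace ℝ (Fin 2) →L[ℝ] ℂ) :
    schoutenBracket (𝓘(ℝ, E).prod (𝓡 2)) g.twistorBivector g.twistorBivector (x₀, a) l m n =
      2 * complexTrilinear ((g.jet x₀).schoutenSq (twistorCoeff a))
        (g.sharpParts x₀ (l ∘L ContinuousLinearMap.inl ℝ E _))
        (g.sharpParts x₀ (m ∘L ContinuousLinearMap.inl ℝ E _))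
        (g.sharpParts x₀ (n ∘L ContinuousLinearMap.inl ℝ E _)) := by
  simp only [schoutenBracket, schoutenTerm_twistorBivector, complexTrilinear, Fin.sum_univ_two,
    HyperhermitianJet.schoutenSq_eq_dualDerivSum]
  simp
  ring

variable {g} in
theorem HyperhermitianMetric.IsHKT.isComplexPoisson (h : g.IsHKT) :
    IsComplexPoisson (𝓘(ℝ, E).prod (𝓡 2)) 𝓗.twistorStructure g.twistorBivector where
  smooth := g.smoothBivector_twistorBivector
  type20 z := component20_component20 (𝓗.twistorStructure_sq z) _
  bracket := by
    rintro ⟨x, a⟩ l m n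
    have hx := g.isHKT_iff_jet.1 h x
    simp only [schoutenBracket_twistorBivector, complexTrilinear,
      hx.schoutenSq_eq_zero (twistorCoeff_isotropic a), mul_zero, Finset.sum_const_zero]

theorem HyperhermitianMetric.sharpParts_ofReal (u : E) :
    g.sharpParts x₀ (Complex.ofRealCLM ∘L (g.jet x₀).g u) = ![u, 0] := by
  have hre : covectorRe (Complex.ofRealCLM ∘L (g.jet x₀).g u) = (g.jet x₀).g u := by
    ext; simp [covectorRe]
  have him : covectorIm (Complex.ofRealCLM ∘L (g.jet x₀).g u) = 0 := by
    ext; simp [covectorIm]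
  rw [sharpParts, hre, him, map_zero]
  exact congrArg (fun w => ![w, (0 : E)])
    (inverse_apply_eq (modelForm_injective g (mem_chart_source E x₀)) rfl)

omit [FiniteDimensional ℝ E] in
theorem HyperhermitianJet.complexTrilinear_schoutenSq_real (j : HyperhermitianJet E)
    (c : Fin 3 → ℂ) (u v w : E) :
    complexTrilinear (j.schoutenSq c) ![u, 0] ![v, 0] ![w, 0] = j.schoutenSq c u v w := by
  simp [complexTrilinear, Fin.sum_univ_two, schoutenSq, cyclicDualDeriv, dualDeriv]

theorem HyperhermitianMetric.schoutenSq_eq_zero_of_schoutenBracket {a : UnitSphere2}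
    (h : ∀ l m n : E × EuclideanSpace ℝ (Fin 2) →L[ℝ] ℂ,
      schoutenBracket (𝓘(ℝ, E).prod (𝓡 2)) g.twistorBivector g.twistorBivector (x₀, a) l m n = 0)
    (u v w : E) : (g.jet x₀).schoutenSq (twistorCoeff a) u v w = 0 := by
  let l (u : E) : E × EuclideanSpace ℝ (Fin 2) →L[ℝ] ℂ :=
    (Complex.ofRealCLM ∘L (g.jet x₀).g u) ∘L ContinuousLinearMap.fst ℝ E _
  have hl (u : E) : l u ∘L ContinuousLinearMap.inl ℝ E (EuclideanSpace ℝ (Fin 2)) =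
      Complex.ofRealCLM ∘L (g.jet x₀).g u := rfl
  have h1 := h (l u) (l v) (l w)
  rw [schoutenBracket_twistorBivector, hl, hl, hl, sharpParts_ofReal, sharpParts_ofReal,
    sharpParts_ofReal, HyperhermitianJet.complexTrilinear_schoutenSq_real] at h1
  simpa using h1

/-- Evaluating the Schouten bracket at the two points `J` and `K` of the twistor sphere is enough
to recover the HKT condition. -/
theorem HyperhermitianMetric.isHKT_of_isComplexPoisson
    (h : IsComplexPoisson (𝓘(ℝ, E).prod (𝓡 2)) 𝓗.twistorStructure g.twistorBivector) :
    g.IsHKT := by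
  refine g.isHKT_iff_jet.2 fun x => ?_
  let aJ : UnitSphere2 := ⟨!₂[0, 1, 0], by
    simp [EuclideanSpace.norm_eq, Fin.sum_univ_three]⟩
  let aK : UnitSphere2 := ⟨!₂[0, 0, 1], by
    simp [EuclideanSpace.norm_eq, Fin.sum_univ_three]⟩
  refine (g.jet x).isHKT_of_schoutenSq (c := twistorCoeff aJ) (d := twistorCoeff aK) ?_ ?_
    (g.schoutenSq_eq_zero_of_schoutenBracket x (h.bracket (x, aJ)))
    (g.schoutenSq_eq_zero_of_schoutenBracket x (h.bracket (x, aK)))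
  · simp [twistorCoeff, aJ]
  · simp [twistorCoeff, aK]

end Schouten
end

theorem theorem3p3 {E : Type*} [NormedAddCommGroup E] [NormedSpace ℝ E] [FiniteDimensional ℝ E]
    {M : Type*} [TopologicalSpace M] [T2Space M] [SecondCountableTopology M] [ChartedSpace E M]
    [IsManifold 𝓘(ℝ, E) ∞ M]
    (𝓗 : HypercomplexStructure E M) (g : HyperhermitianMetric 𝓗) :
    g.IsHKT ↔
      IsComplexPoisson (𝓘(ℝ, E).prod (𝓡 2)) 𝓗.twistorStructure g.twistorBivector :=
  ⟨fun h => h.isComplexPoisson, g.isHKT_of_isComplexPoisson⟩
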